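/- Let $n\ge 1$, let $\alpha=(\alpha_1,\dots,\alpha_m)$ be a composition of $n$ into $m$ positive parts, and let $\pi\in S_n$ be a permutation of cycle type $\alpha$, i.e. the lengths of its disjoint cycles (fixed points included) are $\alpha_1,\dots,\alpha_m$ in some order. Let $g\ge 0$ and let $\beta=(\beta_2,\beta_3,\dots)$ be a finitely supported sequence of nonnegative integers. A *cycle factorization* of $\pi$ is a finite (possibly empty) tuple $f=(\sigma_1,\dots,\sigma_r)$ of cycles $\sigma_i\in S_n$ of length at least $2$ with $\sigma_1\cdots\sigma_r=\pi$ (products are taken from right to left). It has signature $\beta$ if, for every $k\ge 2$, exactly $\beta_k$ of the factors are $k$-cycles. It has genus $g$ if its factors generate a group acting transitively on the $n$ symbols and $\sum_{j\ge 2}(j-1)\beta_j=n+m-2+2g$. Two cycle factorizations are equivalent if one is obtained from the other by repeatedly interchanging adjacent disjoint factors; the equivalence classes are called inequivalent factorizations. A *map of genus $g$* is a connected graph with at least one edge (loops and multiple edges allowed) cellularly embedded in a closed oriented surface of genus $g$. A directed map (one whose edges are directed) is *alternating* if the edges encountered on a cyclic tour around any vertex alternate in direction (no condition at vertices of degree $1$),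 and *acyclic* if it has no directed cycles. A *source* (*sink*) is a vertex all of whose incident edges are directed away from (towards) it. Then the inequivalent factorizations of $\pi$ of genus $g$ with signature $\beta$ are in one-to-one correspondence with the acyclic alternating maps of genus $g$ with $m$ faces, labelled $1,\dots,m$, and with one source distinguished in each face, such that (a) every vertex is a source, a sink, or has even total degree $\ge 4$; (b) for every $i$, face $i$ contains exactly $\alpha_i$ sources and exactly $\alpha_i$ sinks; (c) for every $k\ge 2$, there are exactly $\beta_k$ vertices of degree $2k$. Here maps are considered up to orientation-preserving isomorphism respecting edge directions, face labels and distinguished sources. -/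

import Mathlib

namespace CycleFact

/-! ### Factorizations of permutations -/

/-- The number of `k`-cycles (for `k ≥ 2`) amongst all the factors of the factorization `f`. -/
def signature {n : ℕ} (f : List (Equiv.Perm (Fin n))) (k : ℕ) : ℕ :=
  (f.map fun s => s.cycleType.count k).sum

/-- The depth `∑_{j ≥ 2} (j - 1) β_j`, where `β` is the signature of `f`; cycles of permutations of
an `n`-element set have length at most `n`, so the sum may be stopped at `n`. -/
def depth {n : ℕ} (f : List (Equiv.Perm (Fin n))) : ℕ :=
  ∑ j ∈ Finset.Icc 2 n, (j - 1) * signature f j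

/-- The number of cycles of a permutation, fixed points included. -/
def numCycles {n : ℕ} (p : Equiv.Perm (Fin n)) : ℕ :=
  Multiset.card p.partition.parts

/-- The group generated by the factors acts transitively on the symbols. -/
def IsTransitive {n : ℕ} (f : List (Equiv.Perm (Fin n))) : Prop :=
  MulAction.IsPretransitive (Subgroup.closure {s : Equiv.Perm (Fin n) | s ∈ f}) (Fin n)

/-- `f` is transitive and of genus `g`: `depth f = n + ℓ(π) - 2 + 2 g`, where `π` is the product of
`f` (products are composed from right to left). -/
def HasGenus {n : ℕ} (f : List (Equiv.Perm (Fin n))) (g : ℕ) : Prop :=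
  IsTransitive f ∧ depth f + 2 = n + numCycles f.prod + 2 * g

/-- `f` is a cycle factorization of `p` of genus `g` and signature `β = (β 2, β 3, …)`; the values
`β 0` and `β 1` play no role. -/
structure IsCycleFactorization {n : ℕ} (p : Equiv.Perm (Fin n)) (g : ℕ) (β : ℕ →₀ ℕ)
    (f : List (Equiv.Perm (Fin n))) : Prop where
  isCycle : ∀ s ∈ f, s.IsCycle
  prod_eq : f.prod = p
  genus : HasGenus f g
  signature_eq : ∀ k, 2 ≤ k → signature f k = β k

/-- `f'` arises from `f` by interchanging two adjacent disjoint factors. -/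
def SwapStep {n : ℕ} (f f' : List (Equiv.Perm (Fin n))) : Prop :=
  ∃ (l₁ l₂ : List (Equiv.Perm (Fin n))) (a b : Equiv.Perm (Fin n)),
    a.Disjoint b ∧ f = l₁ ++ a :: b :: l₂ ∧ f' = l₁ ++ b :: a :: l₂

/-- Equivalence of factorizations: one is obtained from the other by iterated interchanges of
adjacent disjoint factors. -/
def swapSetoid (n : ℕ) : Setoid (List (Equiv.Perm (Fin n))) :=
  Relation.EqvGen.setoid SwapStep

/-- The inequivalent factorizations (equivalence classes of cycle factorizations) of `p` of genus
`g` with signature `β`. -/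
def IneqFactorization {n : ℕ} (p : Equiv.Perm (Fin n)) (g : ℕ) (β : ℕ →₀ ℕ) : Type :=
  Quotient ((swapSetoid n).comap
    (Subtype.val : {f : List (Equiv.Perm (Fin n)) // IsCycleFactorization p g β f} → _))

/-! ### Directed maps on oriented surfaces -/

/-- A directed map: a finite connected directed graph (loops and multiple edges allowed, at least
one edge), cellularly embedded in a closed oriented surface, given by its rotation system.
A dart is an edge together with one of its two ends; we say that it sits at that end. -/
structure DirectedMap where
  /-- the darts -/
  Dart : Type
  [finite_dart : Finite Dart]
  [nonempty_dart : Nonempty Dart]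
  /-- the next dart in counter-clockwise order around the vertex at which a dart sits -/
  rot : Equiv.Perm Dart
  /-- the dart at the other end of the same edge -/
  opp : Equiv.Perm Dart
  opp_opp : ∀ d, opp (opp d) = d
  opp_ne : ∀ d, opp d ≠ d
  connected : MulAction.IsPretransitive (Subgroup.closure {rot, opp}) Dart
  /-- the edge is directed away from the vertex at which the dart sits -/
  IsOut : Dart → Prop
  isOut_opp : ∀ d, IsOut (opp d) ↔ ¬ IsOut d

attribute [instance] DirectedMap.finite_dart DirectedMap.nonempty_dart

namespace DirectedMap

variable (M : DirectedMap)

/-- One step of the boundary walk of a face, with the face kept on the right: walk along the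
dart `d` to its other end and leave by the next dart there in counter-clockwise order. -/
def facePerm : Equiv.Perm M.Dart := M.rot * M.opp

/-- Vertices: cycles of the rotation. -/
def Vertex : Type := Quotient (Equiv.Perm.SameCycle.setoid M.rot)

/-- Edges: pairs of opposite darts. -/
def Edge : Type := Quotient (Equiv.Perm.SameCycle.setoid M.opp)

/-- Faces: boundary walks, i.e. cycles of the face permutation. -/
def Face : Type := Quotient (Equiv.Perm.SameCycle.setoid M.facePerm)

/-- The vertex at which a dart sits. -/
def vertexOf (d : M.Dart) : M.Vertex := Quotient.mk (Equiv.Perm.SameCycle.setoid M.rot) d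

/-- The face to the right of a dart, seen from the vertex at which it sits. -/
def faceOf (d : M.Dart) : M.Face := Quotient.mk (Equiv.Perm.SameCycle.setoid M.facePerm) d

/-- Total degree of a vertex (a loop counts twice). -/
noncomputable def degree (v : M.Vertex) : ℕ := Nat.card {d : M.Dart // M.vertexOf d = v}

/-- A source: all edges at the vertex are directed away from it. -/
def IsSource (v : M.Vertex) : Prop := ∀ d, M.vertexOf d = v → M.IsOut d

/-- A sink: all edges at the vertex are directed towards it. -/
def IsSink (v : M.Vertex) : Prop := ∀ d, M.vertexOf d = v → ¬ M.IsOut d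

/-- The vertex lies on the boundary of the face. Every corner at a vertex is the one immediately to
the right of exactly one of the darts at that vertex. -/
def Incident (v : M.Vertex) (F : M.Face) : Prop := ∃ d, M.vertexOf d = v ∧ M.faceOf d = F

/-- The edges met on a cyclic tour around any vertex alternate in direction (no condition at
leaves). -/
def IsAlternating : Prop := ∀ d, M.rot d ≠ d → (M.IsOut (M.rot d) ↔ ¬ M.IsOut d)

/-- There is an edge directed from `u` to `v`. -/
def Arc (u v : M.Vertex) : Prop := ∃ d, M.IsOut d ∧ M.vertexOf d = u ∧ M.vertexOf (M.opp d) = v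

/-- There are no directed cycles (directed loops included). -/
def IsAcyclic : Prop := ∀ v, ¬ Relation.TransGen M.Arc v v

/-- The underlying surface has genus `g`: `V - E + F = 2 - 2 g`. -/
def HasGenus (g : ℕ) : Prop :=
  Nat.card M.Vertex + Nat.card M.Face + 2 * g = Nat.card M.Edge + 2

end DirectedMap

/-- A directed map with `m` faces labelled by `Fin m`, and one source distinguished in each face. -/
structure DecoratedMap (m : ℕ) extends DirectedMap where
  label : toDirectedMap.Face ≃ Fin m
  root : Fin m → toDirectedMap.Vertex
  root_isSource : ∀ i, toDirectedMap.IsSource (root i)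
  root_incident : ∀ i, toDirectedMap.Incident (root i) (label.symm i)

namespace DecoratedMap

variable {m : ℕ}

/-- Isomorphisms of decorated maps (equivalently, orientation-preserving homeomorphisms of the
surfaces respecting all of the structure, up to isotopy). -/
structure Iso (M N : DecoratedMap m) where
  toEquiv : M.Dart ≃ N.Dart
  map_rot : ∀ d, toEquiv (M.rot d) = N.rot (toEquiv d)
  map_opp : ∀ d, toEquiv (M.opp d) = N.opp (toEquiv d)
  map_isOut : ∀ d, N.IsOut (toEquiv d) ↔ M.IsOut d
  map_label : ∀ d, N.label (N.faceOf (toEquiv d)) = M.label (M.faceOf d)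
  map_root : ∀ d i, N.vertexOf (toEquiv d) = N.root i ↔ M.vertexOf d = M.root i

/-- The identity isomorphism. -/
def Iso.refl (M : DecoratedMap m) : Iso M M where
  toEquiv := Equiv.refl _
  map_rot _ := rfl
  map_opp _ := rfl
  map_isOut _ := Iff.rfl
  map_label _ := rfl
  map_root _ _ := Iff.rfl

/-- The inverse isomorphism. -/
def Iso.symm {M N : DecoratedMap m} (e : Iso M N) : Iso N M where
  toEquiv := e.toEquiv.symm
  map_rot d := by
    rw [Equiv.symm_apply_eq, e.map_rot, Equiv.apply_symm_apply]
  map_opp d := by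
    rw [Equiv.symm_apply_eq, e.map_opp, Equiv.apply_symm_apply]
  map_isOut d := by
    rw [← e.map_isOut, Equiv.apply_symm_apply]
  map_label d := by
    rw [← e.map_label, Equiv.apply_symm_apply]
  map_root d i := by
    rw [← e.map_root, Equiv.apply_symm_apply]

/-- Composition of isomorphisms. -/
def Iso.trans {M N P : DecoratedMap m} (e : Iso M N) (e' : Iso N P) : Iso M P where
  toEquiv := e.toEquiv.trans e'.toEquiv
  map_rot d := by simp only [Equiv.trans_apply, e.map_rot, e'.map_rot]
  map_opp d := by simp only [Equiv.trans_apply, e.map_opp, e'.map_opp]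
  map_isOut d := by simp only [Equiv.trans_apply, e.map_isOut, e'.map_isOut]
  map_label d := by simp only [Equiv.trans_apply, e.map_label, e'.map_label]
  map_root d i := by simp only [Equiv.trans_apply, e.map_root, e'.map_root]

/-- Decorated maps are considered up to isomorphism. -/
def isoSetoid (m : ℕ) : Setoid (DecoratedMap m) where
  r M N := Nonempty (Iso M N)
  iseqv :=
    { refl := fun M => ⟨Iso.refl M⟩
      symm := fun ⟨e⟩ => ⟨e.symm⟩
      trans := fun ⟨e⟩ ⟨e'⟩ => ⟨e.trans e'⟩ }

end DecoratedMap

/-- The decorated map `M` is acyclic, alternating and of genus `g`; every vertex is a source, a sink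
or has even degree at least 4; face `i` contains `α i` sources and `α i` sinks; and there are `β k`
vertices of degree `2 k` for all `k ≥ 2`. -/
structure IsAdmissible {m : ℕ} (α : Fin m → ℕ) (g : ℕ) (β : ℕ →₀ ℕ) (M : DecoratedMap m) :
    Prop where
  acyclic : M.IsAcyclic
  alternating : M.IsAlternating
  genus : M.HasGenus g
  vertex : ∀ v, M.IsSource v ∨ M.IsSink v ∨ (Even (M.degree v) ∧ 4 ≤ M.degree v)
  sources : ∀ i, Nat.card {v : M.Vertex // M.IsSource v ∧ M.Incident v (M.label.symm i)} = α i
  sinks : ∀ i, Nat.card {v : M.Vertex // M.IsSink v ∧ M.Incident v (M.label.symm i)} = α i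
  degrees : ∀ k, 2 ≤ k → Nat.card {v : M.Vertex // M.degree v = 2 * k} = β k

/-- Isomorphism classes of admissible decorated maps. -/
def MapClass {m : ℕ} (α : Fin m → ℕ) (g : ℕ) (β : ℕ →₀ ℕ) : Type 1 :=
  Quotient ((DecoratedMap.isoSetoid m).comap
    (Subtype.val : {M : DecoratedMap m // IsAdmissible α g β M} → _))

end CycleFact

/-!
A factorization `π = σ₀ ⋯ σᵣ₋₁` can be drawn as a wiring diagram: each symbol `x` is a thread
running from a source to a sink, and the threads of the symbols moved by `σᵢ` all pass through one
vertex, placed at level `i + 1`. Around that vertex the darts are arranged so that an incoming dart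
is followed by the outgoing dart of the same thread, and the outgoing dart of `x` by the incoming
dart of `σᵢ x`. The result is alternating by construction and acyclic because levels increase along
edges. Its boundary walks go forward along a thread to the sink and then backward, applying the
factors from last to first, so that they pass from the source of `x` to the source of `π x`: faces
are the cycles of `π`. A `k`-cycle gives a vertex of degree `2 k`, and Euler's formula becomes the
genus condition on the depth.

`IsReading` records that a rotation system is this diagram of a list `f`, through the thread and the
level of every dart. The comparison of invariants (`isAdmissible_iff_isCycleFactorization`) is done
once for an arbitrary reading. The bijection then rests on four facts.

* Every transitive factorization is read off some map (`exists_isRootedReading`), and two maps off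
  which the same factorization is read are isomorphic (`IsRootedReading.nonempty_iso`).
* Interchanging adjacent disjoint factors only renumbers two levels (`IsReading.swap_levels`), so
  equivalent factorizations are read off the same maps (`IsRootedReading.of_eqvGen`).
* Conversely, factorizations read off the same map are equivalent (`IsRootedReading.eqvGen`). The
  distinguished sources are placed at fixed base points of the cycles of `π`; as boundary walks
  realize `π`, this determines the threads. The map then determines, for each symbol, the sequence
  of the factors moving it, and these sequences determine a factorization up to equivalence
  (`eqvGen_swapStep_of_filter_eq`).
* Every admissible map has a reading (`exists_isRootedReading_of_isAdmissible`): following the edges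
  of an acyclic alternating map splits it into threads, a linear extension of the order of its inner
  vertices supplies levels, and the rotation by two darts at an inner vertex is a cycle on the
  threads through it. An arbitrary labelling of the sources yields a factorization of some
  permutation with the same cycle lengths as `π`, which is conjugated into `π` compatibly with the
  base points (`exists_conj_of_cycleIndex`).
-/

namespace CycleFact

open Equiv

/-! ### Auxiliary facts on permutations, quotients and finite orders -/

/-- The group generated by `S` is transitive if and only if no nonempty proper subset is invariant
under all elements of `S`. -/
theorem isPretransitive_closure_iff {X : Type*} (S : Set (Perm X)) :
    MulAction.IsPretransitive (Subgroup.closure S) X ↔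
      ∀ P : X → Prop, (∀ s ∈ S, ∀ x, P (s x) ↔ P x) → ∀ x y, P x → P y := by
  constructor
  · intro h P hP x y hx
    obtain ⟨⟨g, hg⟩, rfl⟩ := h.exists_smul_eq x y
    have key : ∀ z, P (g z) ↔ P z := by
      induction hg using Subgroup.closure_induction with
      | mem s hs => exact hP s hs
      | one => exact fun z => Iff.rfl
      | mul a b _ _ ha hb => exact fun z => (ha (b z)).trans (hb z)
      | inv a _ ha =>
        intro z
        simpa using (ha (a⁻¹ z)).symm
    exact (key x).2 hx
  · intro h
    refine ⟨fun x y => ?_⟩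
    refine h (fun z => ∃ g : Subgroup.closure S, g • x = z) ?_ x y ⟨1, one_smul _ _⟩
    intro s hs z
    constructor
    · rintro ⟨g, hg⟩
      refine ⟨⟨s, Subgroup.subset_closure hs⟩⁻¹ * g, ?_⟩
      rw [mul_smul, hg, inv_smul_eq_iff]
      rfl
    · rintro ⟨g, rfl⟩
      exact ⟨⟨s, Subgroup.subset_closure hs⟩ * g, mul_smul _ _ _⟩

theorem natCard_quotient_eq {X T : Type*} (s : Setoid X) (F : X → T)
    (hs : Function.Surjective F) (h : ∀ x y, F x = F y ↔ s x y) :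
    Nat.card (Quotient s) = Nat.card T := by
  refine Nat.card_congr (Equiv.ofBijective
    (Quotient.lift F fun x y hxy => (h x y).2 hxy) ⟨?_, ?_⟩)
  · intro a b
    induction a using Quotient.inductionOn
    induction b using Quotient.inductionOn
    exact fun hab => Quotient.sound ((h _ _).1 hab)
  · intro t
    obtain ⟨x, rfl⟩ := hs t
    exact ⟨Quotient.mk s x, rfl⟩

/-- Every acyclic relation on a finite type has a linear extension. -/
theorem exists_equiv_fin_of_acyclic {I : Type*} [Finite I] (R : I → I → Prop)
    (hR : ∀ a, ¬ Relation.TransGen R a a) :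
    ∃ (r : ℕ) (e : I ≃ Fin r), ∀ a b, R a b → e a < e b := by
  classical
  have := Fintype.ofFinite I
  let po : PartialOrder I :=
    { le := Relation.ReflTransGen R
      le_refl := fun a => Relation.ReflTransGen.refl
      le_trans := fun a b c => Relation.ReflTransGen.trans
      le_antisymm := fun a b hab hba => by
        rcases Relation.reflTransGen_iff_eq_or_transGen.1 hab with h | h
        · exact h.symm
        · exact absurd (h.trans_left hba) (hR a) }
  let : Fintype (LinearExtension I) := inferInstanceAs (Fintype I)
  let e := Fintype.orderIsoFinOfCardEq (LinearExtension I) rfl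
  refine ⟨_, (Equiv.refl I : I ≃ LinearExtension I).trans e.symm.toEquiv, fun a b hab => ?_⟩
  have hle : (toLinearExtension a : LinearExtension I) ≤ toLinearExtension b :=
    toLinearExtension.monotone (Relation.ReflTransGen.single hab)
  have hne : a ≠ b := by
    rintro rfl
    exact hR a (Relation.TransGen.single hab)
  exact e.symm.strictMono (lt_of_le_of_ne hle hne)

/-- Two families of numbers with the same values and multiplicities differ by a relabelling. -/
theorem exists_equiv_of_map_univ_eq {J K : Type*} [Fintype J] [Fintype K] (f : J → ℕ) (g : K → ℕ)
    (h : (Finset.univ : Finset J).val.map f = (Finset.univ : Finset K).val.map g) :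
    ∃ e : J ≃ K, ∀ j, g (e j) = f j := by
  classical
  have hc : ∀ k, Nonempty ({j // f j = k} ≃ {i // g i = k}) := by
    intro k
    have := congrArg (Multiset.count k) h
    rw [Multiset.count_map, Multiset.count_map] at this
    refine ⟨Fintype.equivOfCardEq ?_⟩
    rw [Fintype.card_subtype, Fintype.card_subtype, Finset.card_def, Finset.card_def,
      Finset.filter_val, Finset.filter_val]
    simpa [eq_comm] using this
  let e := fun k => Classical.choice (hc k)
  refine ⟨(Equiv.sigmaFiberEquiv f).symm.trans
    ((Equiv.sigmaCongrRight e).trans (Equiv.sigmaFiberEquiv g)), fun j => ?_⟩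
  exact (e (f j) ⟨j, rfl⟩).2

/-- The cycles of a permutation can be indexed by any family listing their lengths. -/
theorem exists_cycleIndex {n m : ℕ} (p : Perm (Fin n)) (a : Fin m → ℕ)
    (h : p.partition.parts = (Finset.univ : Finset (Fin m)).val.map a) :
    ∃ c : Fin n → Fin m, (∀ x y, c x = c y ↔ p.SameCycle x y) ∧
      ∀ i, Nat.card {x // c x = i} = a i := by
  classical
  let size : {q // q ∈ p.cycleFactorsFinset} ⊕ {x // p x = x} → ℕ :=
    Sum.elim (fun q => q.1.support.card) (fun _ => 1)
  let cyc : Fin n → {q // q ∈ p.cycleFactorsFinset} ⊕ {x // p x = x} := fun x =>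
    if hx : p x = x then Sum.inr ⟨x, hx⟩ else
    Sum.inl ⟨p.cycleOf x, Perm.cycleOf_mem_cycleFactorsFinset_iff.2 (Perm.mem_support.2 hx)⟩
  have hcyc : ∀ x y, cyc x = cyc y ↔ p.SameCycle x y := by
    intro x y
    by_cases hx : p x = x <;> by_cases hy : p y = y
    · simp only [cyc, hx, hy, dif_pos, Sum.inr.injEq, Subtype.mk.injEq]
      exact ⟨fun hxy => hxy ▸ Perm.SameCycle.rfl, fun hxy => hxy.eq_of_left hx⟩
    · simp only [cyc, hx, hy, dif_pos, dif_neg, not_false_eq_true, reduceCtorEq, false_iff]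
      exact fun hxy => hy (hxy.apply_eq_self_iff.1 hx)
    · simp only [cyc, hx, hy, dif_pos, dif_neg, not_false_eq_true, reduceCtorEq, false_iff]
      exact fun hxy => hx (hxy.apply_eq_self_iff.2 hy)
    · simp only [cyc, hx, hy, dif_neg, not_false_eq_true, Sum.inl.injEq, Subtype.mk.injEq]
      exact (Perm.sameCycle_iff_cycleOf_eq_of_mem_support (Perm.mem_support.2 hx)
        (Perm.mem_support.2 hy)).symm
  have hfib : ∀ j, Nat.card {x // cyc x = j} = size j := by
    rintro (⟨q, hq⟩ | ⟨x, hx⟩)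
    · simp only [size, Sum.elim_inl]
      rw [← Nat.card_eq_finsetCard]
      refine Nat.card_congr (Equiv.subtypeEquivRight fun x => ?_)
      rw [← Perm.eq_cycleOf_of_mem_cycleFactorsFinset_iff p q hq]
      by_cases hx : p x = x
      · simp only [cyc, hx, dif_pos, reduceCtorEq, false_iff]
        rintro rfl
        exact (Perm.cycleOf_mem_cycleFactorsFinset_iff.1 hq |> Perm.mem_support.1) hx
      · simp only [cyc, hx, dif_neg, not_false_eq_true, Sum.inl.injEq, Subtype.mk.injEq]
        exact eq_comm
    · simp only [size, Sum.elim_inr]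
      rw [Nat.card_eq_one_iff_unique]
      have hxx : cyc x = Sum.inr ⟨x, hx⟩ := by simp [cyc, hx]
      refine ⟨⟨fun u v => ?_⟩, ⟨⟨x, hxx⟩⟩⟩
      have key : ∀ u, cyc u = Sum.inr ⟨x, hx⟩ → x = u := fun u hu =>
        ((hcyc x u).1 (hxx.trans hu.symm)).eq_of_left hx
      exact Subtype.ext ((key u u.2).symm.trans (key v v.2))
  have hsize : Finset.univ.val.map size = p.partition.parts := by
    rw [Perm.parts_partition, Perm.cycleType_def]
    have : (Finset.univ : Finset ({q // q ∈ p.cycleFactorsFinset} ⊕ {x // p x = x})).val =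
        (Finset.univ.val).map Sum.inl + (Finset.univ.val).map Sum.inr := rfl
    rw [this, Multiset.map_add, Multiset.map_map, Multiset.map_map]
    congr 1
    · change Multiset.map (fun q : {q // q ∈ p.cycleFactorsFinset} => q.1.support.card) _ = _
      have hv : (Finset.univ : Finset {q // q ∈ p.cycleFactorsFinset}).val.map Subtype.val =
        p.cycleFactorsFinset.val := by
        exact Multiset.attach_map_val p.cycleFactorsFinset.val
      conv_rhs => rw [← hv, Multiset.map_map]
      rfl
    · change Multiset.map (fun _ => 1) _ = _
      rw [Multiset.map_const']
      congr 1
      have h1 := Finset.card_compl p.support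
      rw [← h1, ← Finset.card_def, Finset.card_univ, Fintype.card_subtype]
      congr 1
      ext x
      simp
  obtain ⟨e, he⟩ := exists_equiv_of_map_univ_eq size a (hsize.trans h)
  refine ⟨fun x => e (cyc x), fun x y => by rw [e.apply_eq_iff_eq, hcyc], fun i => ?_⟩
  have hi := hfib (e.symm i)
  rw [← he, e.apply_symm_apply] at hi
  rw [← hi]
  exact Nat.card_congr (Equiv.subtypeEquivRight fun x => e.eq_symm_apply.symm)

/-- Two permutations whose cycles are indexed by the same type, with equal lengths, and which have
a chosen point in each cycle, are conjugate by a permutation matching up the chosen points. -/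
theorem exists_conj_of_cycleIndex {X I : Type*} [Finite X] (p q : Perm X) (c d : X → I)
    (hc : ∀ x y, c x = c y ↔ p.SameCycle x y) (hd : ∀ x y, d x = d y ↔ q.SameCycle x y)
    (hcard : ∀ i, Nat.card {x // c x = i} = Nat.card {x // d x = i})
    (b b' : I → X) (hb : ∀ i, c (b i) = i) (hb' : ∀ i, d (b' i) = i) :
    ∃ t : Perm X, (∀ x, t (p x) = q (t x)) ∧ ∀ i, t (b i) = b' i := by
  classical
  have hper : ∀ (p : Perm X) (c : X → I), (∀ x y, c x = c y ↔ p.SameCycle x y) → ∀ b : I → X,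
      (∀ i, c (b i) = i) → ∀ i,
      Function.minimalPeriod (p • ·) (b i) = Nat.card {x // c x = i} := by
    intro p c hc b hb i
    have := Fintype.ofFinite (MulAction.orbit (Subgroup.zpowers p) (b i))
    rw [MulAction.minimalPeriod_eq_card, ← Nat.card_eq_fintype_card]
    refine Nat.card_congr (Equiv.subtypeEquivRight fun x => ?_)
    rw [← hb i, hc, Perm.sameCycle_comm]
    simp only [hb]
    constructor
    · rintro ⟨⟨_, k, rfl⟩, rfl⟩
      exact ⟨k, rfl⟩
    · rintro ⟨k, rfl⟩
      exact ⟨⟨_, k, rfl⟩, rfl⟩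
  -- the two chosen points of index `i` have the same period
  have hz : ∀ i (k l : ℤ), (p ^ k) (b i) = (p ^ l) (b i) ↔ (q ^ k) (b' i) = (q ^ l) (b' i) := by
    have key : ∀ (p : Perm X) (x : X) (k l : ℤ), (p ^ k) x = (p ^ l) x ↔
        (Function.minimalPeriod (p • ·) x : ℤ) ∣ k - l := by
      intro p x k l
      rw [← MulAction.zpow_smul_eq_iff_minimalPeriod_dvd, sub_eq_neg_add, zpow_add, zpow_neg,
        mul_smul, inv_smul_eq_iff]
      rfl
    intro i k l
    rw [key, key, hper p c hc b hb, hper q d hd b' hb', hcard]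
  have hex : ∀ x, ∃ k : ℤ, (p ^ k) (b (c x)) = x := fun x => (hc _ _).1 (hb (c x))
  choose k hk using hex
  have hcp : ∀ x, c (p x) = c x := fun x =>
    (hc _ _).2 (Perm.sameCycle_apply_left.2 Perm.SameCycle.rfl)
  have hdq : ∀ (j : ℤ) x, d ((q ^ j) x) = d x := fun j x =>
    (hd _ _).2 (Perm.sameCycle_zpow_left.2 Perm.SameCycle.rfl)
  let t : X → X := fun x => (q ^ k x) (b' (c x))
  have hdt : ∀ x, d (t x) = c x := fun x => by rw [hdq, hb']
  have ht : Function.Injective t := by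
    intro x y hxy
    have hcxy : c x = c y := by rw [← hdt, ← hdt, hxy]
    simp only [t, hcxy] at hxy
    rw [← hk x, ← hk y, hcxy]
    exact (hz _ _ _).2 hxy
  refine ⟨Equiv.ofBijective t (Finite.injective_iff_bijective.1 ht), fun x => ?_, fun i => ?_⟩
  · change t (p x) = q (t x)
    have h1 : (p ^ k (p x)) (b (c x)) = (p ^ (1 + k x)) (b (c x)) := by
      rw [zpow_add, zpow_one, Perm.mul_apply, hk, ← hcp x, hk]
    have h2 := (hz _ _ _).1 h1
    simp only [t]
    rw [hcp, h2, zpow_add, zpow_one, Perm.mul_apply]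
  · change t (b i) = b' i
    have h1 : (p ^ k (b i)) (b i) = (p ^ (0 : ℤ)) (b i) := by
      have := hk (b i)
      rw [hb] at this
      rw [this]
      rfl
    simpa [t, hb] using (hz i _ 0).1 h1

/-! ### Commutation classes of factorizations -/

theorem SwapStep.symm {n : ℕ} {f f' : List (Perm (Fin n))} (h : SwapStep f f') :
    SwapStep f' f := by
  obtain ⟨l₁, l₂, a, b, hab, rfl, rfl⟩ := h
  exact ⟨l₁, l₂, b, a, hab.symm, rfl, rfl⟩

theorem SwapStep.cons {n : ℕ} {f f' : List (Perm (Fin n))} (s : Perm (Fin n))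
    (h : SwapStep f f') : SwapStep (s :: f) (s :: f') := by
  obtain ⟨l₁, l₂, a, b, hab, rfl, rfl⟩ := h
  exact ⟨s :: l₁, l₂, a, b, hab, rfl, rfl⟩

theorem eqvGen_swapStep_cons {n : ℕ} {f f' : List (Perm (Fin n))} (s : Perm (Fin n))
    (h : Relation.EqvGen SwapStep f f') : Relation.EqvGen SwapStep (s :: f) (s :: f') := by
  induction h with
  | rel _ _ h => exact .rel _ _ (h.cons s)
  | refl _ => exact .refl _
  | symm _ _ _ ih => exact ih.symm
  | trans _ _ _ _ _ ih₁ ih₂ => exact ih₁.trans _ _ _ ih₂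

/-- A factor moves across any number of factors disjoint from it. -/
theorem eqvGen_swapStep_move {n : ℕ} (s : Perm (Fin n)) (l₁ l₂ : List (Perm (Fin n)))
    (h : ∀ a ∈ l₁, s.Disjoint a) :
    Relation.EqvGen SwapStep (s :: (l₁ ++ l₂)) (l₁ ++ s :: l₂) := by
  induction l₁ with
  | nil => exact .refl _
  | cons a l₁ ih =>
    refine .trans _ _ _ (.rel _ _ ⟨[], l₁ ++ l₂, s, a, h a (by simp), rfl, rfl⟩) ?_
    exact eqvGen_swapStep_cons a (ih fun b hb => h b (by simp [hb]))

open Classical in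
/-- The projection lemma for commutation classes: a word is determined up to interchanges of
adjacent disjoint letters by its subwords of letters moving a given symbol. -/
theorem eqvGen_swapStep_of_filter_eq {n : ℕ} (f f' : List (Perm (Fin n)))
    (hf : ∀ s ∈ f, s ≠ 1) (hf' : ∀ s ∈ f', s ≠ 1)
    (h : ∀ x, f.filter (fun s => s x ≠ x) = f'.filter (fun s => s x ≠ x)) :
    Relation.EqvGen SwapStep f f' := by
  have hmove : ∀ s : Perm (Fin n), s ≠ 1 → ∃ x, s x ≠ x := fun s hs => by
    by_contra! hc
    exact hs (Equiv.ext hc)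
  induction f generalizing f' with
  | nil =>
    cases f' with
    | nil => exact .refl _
    | cons a f' =>
      obtain ⟨x, hx⟩ := hmove a (hf' a (by simp))
      have := h x
      simp [hx] at this
  | cons s f ih =>
    obtain ⟨x, hx⟩ := hmove s (hf s (by simp))
    have hs : s ∈ f' := by
      have h1 : s ∈ f'.filter (fun s => s x ≠ x) := by
        rw [← h x]
        simp [hx]
      exact (List.mem_filter.1 h1).1
    obtain ⟨l₁, l₂, rfl, hs₁⟩ : ∃ l₁ l₂, f' = l₁ ++ s :: l₂ ∧ s ∉ l₁ := by
      obtain ⟨l₁, l₂, h1, h2⟩ := List.eq_append_cons_of_mem hs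
      exact ⟨l₁, l₂, h1, h2⟩
    -- a letter before the first `s` sharing a symbol with `s` would precede `s` in a projection
    have hnil : ∀ y, s y ≠ y → l₁.filter (fun s => s y ≠ y) = [] := by
      intro y hy
      have hy' := h y
      rw [List.filter_append] at hy'
      rcases hl : l₁.filter (fun s => s y ≠ y) with _ | ⟨a, l⟩
      · exact hl
      · rw [hl] at hy'
        simp only [ne_eq, hy, not_false_eq_true, decide_true, List.filter_cons_of_pos,
          List.cons_append, List.cons.injEq] at hy'
        have : a ∈ l₁.filter (fun s => s y ≠ y) := by rw [hl]; simp
        exact absurd (hy'.1 ▸ (List.mem_filter.1 this).1) hs₁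
    have hdisj : ∀ a ∈ l₁, s.Disjoint a := by
      intro a ha y
      by_contra! hc
      have : a ∈ l₁.filter (fun s => s y ≠ y) := List.mem_filter.2 ⟨ha, by simpa using hc.2⟩
      rw [hnil y hc.1] at this
      simp at this
    refine .trans _ _ _ (eqvGen_swapStep_cons s (ih (l₁ ++ l₂) ?_ ?_ ?_))
      (eqvGen_swapStep_move s l₁ l₂ hdisj)
    · exact fun a ha => hf a (by simp [ha])
    · intro a ha
      refine hf' a ?_
      simp only [List.mem_append, List.mem_cons] at ha ⊢
      tauto
    · intro y
      have hy := h y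
      by_cases hsy : s y = y
      · simpa [List.filter_append, hsy] using hy
      · rw [List.filter_append, hnil y hsy] at hy ⊢
        simpa [hsy] using hy

/-! ### Signatures of lists of cycles -/

theorem signature_cons {n : ℕ} (s : Perm (Fin n)) (f : List (Perm (Fin n))) (k : ℕ) :
    signature (s :: f) k = s.cycleType.count k + signature f k := by
  simp [signature]

theorem signature_eq_count {n : ℕ} (f : List (Perm (Fin n))) (hf : ∀ s ∈ f, s.IsCycle) (k : ℕ) :
    signature f k = (f.map fun s => s.support.card).count k := by
  induction f with
  | nil => simp [signature]
  | cons s f ih =>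
    rw [signature_cons, ih fun a ha => hf a (by simp [ha]), (hf s (by simp)).cycleType,
      List.map_cons, List.count_cons, Multiset.count_singleton, add_comm]
    simp only [beq_iff_eq, @eq_comm _ k]

/-- For lists of cycles the depth is the sum of the numbers `k - 1` over the cycle lengths `k`;
stated without subtraction. -/
theorem depth_add_length {n : ℕ} (f : List (Perm (Fin n))) (hf : ∀ s ∈ f, s.IsCycle) :
    depth f + f.length = (f.map fun s => s.support.card).sum := by
  induction f with
  | nil => simp [depth, signature]
  | cons s f ih =>
    have hs := hf s (by simp)
    have h2 := hs.two_le_card_support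
    have hn : s.support.card ≤ n := by
      simpa using s.support.card_le_univ
    have : depth (s :: f) = (s.support.card - 1) + depth f := by
      simp only [depth, signature_cons, mul_add, Finset.sum_add_distrib]
      congr 1
      simp only [hs.cycleType, Multiset.count_singleton]
      rw [Finset.sum_eq_single s.support.card]
      · simp
      · intro j _ hj
        simp [hj]
      · intro hj
        exact absurd (Finset.mem_Icc.2 ⟨h2, hn⟩) hj
    rw [this, List.map_cons, List.sum_cons, ← ih fun a ha => hf a (by simp [ha]),
      List.length_cons]
    omega

/-! ### Readings of a factorization off a rotation system -/

/-- The factor number `i` (counted from `0`), and the identity beyond the end of the list. -/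
def fac {n : ℕ} (f : List (Perm (Fin n))) (i : ℕ) : Perm (Fin n) := f.getD i 1

/-- The rotation system `rot`, `opp`, `out` is the map of the factorization `f`: the dart `d` lies
on the thread `thr d` and sits at level `lev d`. Level `0` holds the sources, one for each thread,
level `i + 1` holds the vertex of the factor number `i`, through which run the threads of the
symbols moved by that factor, and level `f.length + 1` holds the sinks. Along each thread levels
increase, at an inner vertex an incoming dart is followed counter-clockwise by the outgoing dart of
the same thread, and an outgoing dart by the incoming dart of the image of its thread. Connectedness
is not required. -/
structure IsReading {D : Type} {n : ℕ} (rot opp : Perm D) (out : D → Prop)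
    (f : List (Perm (Fin n))) (thr : D → Fin n) (lev : D → ℕ) : Prop where
  opp_opp : ∀ d, opp (opp d) = d
  out_opp : ∀ d, out (opp d) ↔ ¬ out d
  inj : ∀ d d', thr d = thr d' → lev d = lev d' → (out d ↔ out d') → d = d'
  exists_source : ∀ x, ∃ d, out d ∧ thr d = x ∧ lev d = 0
  exists_sink : ∀ x, ∃ d, ¬ out d ∧ thr d = x ∧ lev d = f.length + 1
  exists_out : ∀ x i, fac f i x ≠ x → ∃ d, out d ∧ thr d = x ∧ lev d = i + 1
  out_cases : ∀ d, out d → lev d = 0 ∨ ∃ i, lev d = i + 1 ∧ fac f i (thr d) ≠ thr d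
  in_cases : ∀ d, ¬ out d → lev d = f.length + 1 ∨ ∃ i, lev d = i + 1 ∧ fac f i (thr d) ≠ thr d
  rot_source : ∀ d, out d → lev d = 0 → rot d = d
  rot_sink : ∀ d, ¬ out d → lev d = f.length + 1 → rot d = d
  rot_out : ∀ d i, out d → lev d = i + 1 →
    ¬ out (rot d) ∧ thr (rot d) = fac f i (thr d) ∧ lev (rot d) = i + 1
  rot_in : ∀ d, ¬ out d → lev d ≠ f.length + 1 →
    out (rot d) ∧ thr (rot d) = thr d ∧ lev (rot d) = lev d
  thr_opp : ∀ d, thr (opp d) = thr d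
  lev_lt : ∀ d, out d → lev d < lev (opp d)
  gap : ∀ d i, out d → lev d < i + 1 → i + 1 < lev (opp d) → fac f i (thr d) = thr d

section Fac

variable {n : ℕ} (f : List (Perm (Fin n)))

theorem fac_of_lt {i : ℕ} (h : i < f.length) : fac f i = f[i] := by simp [fac, h]

theorem fac_mem {i : ℕ} (h : i < f.length) : fac f i ∈ f := by
  rw [fac_of_lt f h]
  exact List.getElem_mem h

theorem fac_of_le {i : ℕ} (h : f.length ≤ i) : fac f i = 1 := by simp [fac, h]

theorem lt_of_fac_ne {i : ℕ} {x : Fin n} (h : fac f i x ≠ x) : i < f.length := by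
  by_contra! hi
  exact h (by simp [fac_of_le f hi])

theorem prod_take_succ (i : ℕ) : (f.take (i + 1)).prod = (f.take i).prod * fac f i := by
  rcases lt_or_ge i f.length with hi | hi
  · rw [List.prod_take_succ f i hi, fac_of_lt f hi]
  · rw [fac_of_le f hi, List.take_of_length_le (by omega), List.take_of_length_le hi, mul_one]

/-- Factors fixing `x` do not contribute to the value of a partial product at `x`. -/
theorem prod_take_of_fixed {i j : ℕ} (hij : i ≤ j) {x : Fin n}
    (h : ∀ k, i ≤ k → k < j → fac f k x = x) : (f.take j).prod x = (f.take i).prod x := by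
  induction j, hij using Nat.le_induction with
  | base => rfl
  | succ j hij ih =>
    rw [prod_take_succ, Perm.mul_apply, h j hij (by omega)]
    exact ih fun k h1 h2 => h k h1 (by omega)

theorem exists_fac_ne {f : List (Perm (Fin n))} (hf : ∀ s ∈ f, s.IsCycle) {i : ℕ}
    (hi : i < f.length) :
    ∃ x, fac f i x ≠ x := by
  obtain ⟨x, hx, -⟩ := hf _ (fac_mem f hi)
  exact ⟨x, hx⟩

open Classical in
/-- Factors fixing `x` do not contribute to the subsequence of factors moving `x`. -/
theorem filter_drop_of_fixed {x : Fin n} {j i : ℕ}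
    (hji : j ≤ i) (h : ∀ k, j ≤ k → k < i → fac f k x = x) :
    (f.drop j).filter (fun s => s x ≠ x) = (f.drop i).filter (fun s => s x ≠ x) := by
  induction i, hji using Nat.le_induction with
  | base => rfl
  | succ i hji ih =>
    rw [ih fun k h1 h2 => h k h1 (by omega)]
    rcases lt_or_ge i f.length with hi | hi
    · have := h i hji (by omega)
      rw [fac_of_lt f hi] at this
      rw [List.drop_eq_getElem_cons hi, List.filter_cons_of_neg (by simpa using this)]
    · rw [List.drop_of_length_le hi, List.drop_of_length_le (by omega)]

theorem fac_append_cons (l₁ l₂ : List (Perm (Fin n)))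
    (a b : Perm (Fin n)) :
    fac (l₁ ++ a :: b :: l₂) l₁.length = a ∧ fac (l₁ ++ a :: b :: l₂) (l₁.length + 1) = b := by
  constructor <;> simp [fac]

end Fac

theorem apply_eq_of_sameCycle {X Y : Type*} [Finite X] {q : Perm X} {F : X → Y}
    (hF : ∀ x, F (q x) = F x) {x y : X} (hxy : q.SameCycle x y) : F x = F y := by
  obtain ⟨k, rfl⟩ := hxy.exists_nat_pow_eq
  induction k with
  | zero => rfl
  | succ k ih =>
    rw [pow_succ', Perm.mul_apply, hF]
    exact ih ⟨k, by simp⟩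

open Classical in
/-- The symbol of the source which the boundary walk through a dart meets next (incoming darts) or
has met last (outgoing darts). -/
noncomputable def faceSymbol (out : D → Prop) (f : List (Perm (Fin n)))
    (thr : D → Fin n) (lev : D → ℕ) (d : D) : Fin n :=
  if out d then thr d else (f.take (lev d - 1)).prod (thr d)

theorem faceSymbol_sink {D : Type} {n : ℕ} {out : D → Prop} {f : List (Perm (Fin n))}
    {thr : D → Fin n} {lev : D → ℕ} {d : D} (hd : ¬ out d) (hl : lev d = f.length + 1) :
    faceSymbol out f thr lev d = f.prod (thr d) := by
  simp [faceSymbol, hd, hl]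

namespace IsReading

variable {D : Type} {n : ℕ} {rot opp : Perm D} {out : D → Prop}
  {f : List (Perm (Fin n))} {thr : D → Fin n} {lev : D → ℕ}
  (h : IsReading rot opp out f thr lev)
include h

theorem lev_le_of_out {d : D} (hd : out d) : lev d ≤ f.length := by
  rcases h.out_cases d hd with h0 | ⟨i, hi, hx⟩
  · omega
  · have := lt_of_fac_ne f hx
    omega

theorem lev_pos_of_in {d : D} (hd : ¬ out d) : 0 < lev d := by
  rcases h.in_cases d hd with h0 | ⟨i, hi, hx⟩ <;> omega

theorem lev_le (d : D) : lev d ≤ f.length + 1 := by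
  by_cases hd : out d
  · have := h.lev_le_of_out hd
    omega
  · rcases h.in_cases d hd with h0 | ⟨i, hi, hx⟩
    · omega
    · have := lt_of_fac_ne f hx
      omega

/-- The threads through an inner level are those of symbols moved by the factor. -/
theorem moved {d : D} {i : ℕ} (hi : lev d = i + 1) (hlt : i < f.length) :
    fac f i (thr d) ≠ thr d := by
  by_cases hd : out d
  · rcases h.out_cases d hd with h0 | ⟨j, hj, hx⟩
    · omega
    · obtain rfl : i = j := by omega
      exact hx
  · rcases h.in_cases d hd with h0 | ⟨j, hj, hx⟩
    · omega
    · obtain rfl : i = j := by omega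
      exact hx

theorem exists_rot_eq_out {d : D} (hd : out d) (h0 : lev d ≠ 0) :
    ∃ d', rot d' = d ∧ ¬ out d' ∧ thr d' = thr d ∧ lev d' = lev d := by
  refine ⟨rot.symm d, by simp, ?_⟩
  have hr : rot (rot.symm d) = d := by simp
  generalize rot.symm d = e at hr
  have he : ¬ out e := by
    intro he
    rcases h.out_cases e he with h1 | ⟨i, hi, -⟩
    · rw [h.rot_source e he h1] at hr
      exact h0 (hr ▸ h1)
    · exact (h.rot_out e i he hi).1 (hr ▸ hd)
  have hl : lev e ≠ f.length + 1 := by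
    intro hl
    rw [h.rot_sink e he hl] at hr
    exact he (hr ▸ hd)
  obtain ⟨-, h2, h3⟩ := h.rot_in e he hl
  rw [hr] at h2 h3
  exact ⟨he, h2.symm, h3.symm⟩

theorem exists_in (x : Fin n) (i : ℕ) (hx : fac f i x ≠ x) :
    ∃ d, ¬ out d ∧ thr d = x ∧ lev d = i + 1 := by
  obtain ⟨d, hd, ht, hl⟩ := h.exists_out ((fac f i)⁻¹ x) i (by
    intro hc
    apply hx
    simpa using congrArg (fac f i) hc)
  obtain ⟨h1, h2, h3⟩ := h.rot_out d i hd hl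
  exact ⟨rot d, h1, by rw [h2, ht]; simp, h3⟩

theorem lev_rot (d : D) : lev (rot d) = lev d := by
  by_cases hd : out d
  · rcases h.out_cases d hd with h0 | ⟨i, hi, -⟩
    · rw [h.rot_source d hd h0]
    · rw [(h.rot_out d i hd hi).2.2, hi]
  · by_cases hl : lev d = f.length + 1
    · rw [h.rot_sink d hd hl]
    · exact (h.rot_in d hd hl).2.2

theorem rot_eq_self_iff (d : D) : rot d = d ↔ lev d = 0 ∨ lev d = f.length + 1 := by
  constructor
  · intro hr
    by_contra! hc
    by_cases hd : out d
    · rcases h.out_cases d hd with h0 | ⟨i, hi, -⟩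
      · exact hc.1 h0
      · exact (h.rot_out d i hd hi).1 (hr.symm ▸ hd)
    · exact hd (hr ▸ (h.rot_in d hd hc.2).1)
  · rintro (h0 | h0)
    · refine h.rot_source d ?_ h0
      by_contra hd
      have := h.lev_pos_of_in hd
      omega
    · refine h.rot_sink d ?_ h0
      intro hd
      have := h.lev_le_of_out hd
      omega

/-- The vertices of the map, level by level. -/
theorem sameCycle_rot_iff [Finite D] (hf : ∀ s ∈ f, s.IsCycle) (d d' : D) :
    rot.SameCycle d d' ↔
      lev d = lev d' ∧ (lev d = 0 ∨ lev d = f.length + 1 → thr d = thr d') := by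
  constructor
  · intro hs
    refine ⟨apply_eq_of_sameCycle h.lev_rot hs, fun hl => ?_⟩
    rw [hs.eq_of_left ((h.rot_eq_self_iff d).2 hl)]
  · rintro ⟨hl, ht⟩
    rcases Nat.eq_zero_or_pos (lev d) with h0 | hpos
    · have ho : ∀ e, lev e = 0 → out e := fun e he => by
        by_contra hd
        have := h.lev_pos_of_in hd
        omega
      rw [h.inj d d' (ht (.inl h0)) hl (by simp [ho d h0, ho d' (hl ▸ h0)])]
    by_cases hr : lev d = f.length + 1
    · have ho : ∀ e, lev e = f.length + 1 → ¬ out e := fun e he hd => by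
        have := h.lev_le_of_out hd
        omega
      rw [h.inj d d' (ht (.inr hr)) hl (by simp [ho d hr, ho d' (hl ▸ hr)])]
    obtain ⟨i, hi⟩ : ∃ i, lev d = i + 1 := ⟨lev d - 1, by omega⟩
    have hlt : i < f.length := by
      have := h.lev_le d
      omega
    -- it suffices to compare outgoing darts, whose threads form one cycle of the factor
    have main : ∀ d d', out d → out d' → lev d = i + 1 → lev d' = i + 1 →
        rot.SameCycle d d' := by
      intro d d' hd hd' hl hl'
      obtain ⟨k, hk⟩ := (hf _ (fac_mem f hlt)).exists_pow_eq (h.moved hl hlt) (h.moved hl' hlt)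
      have step : ∀ k : ℕ, ∃ e, rot.SameCycle d e ∧ out e ∧ lev e = i + 1 ∧
          thr e = (fac f i ^ k) (thr d) := by
        intro k
        induction k with
        | zero => exact ⟨d, .rfl, hd, hl, rfl⟩
        | succ k ih =>
          obtain ⟨e, h1, h2, h3, h4⟩ := ih
          obtain ⟨h5, h6, h7⟩ := h.rot_out e i h2 h3
          obtain ⟨h8, h9, h10⟩ := h.rot_in (rot e) h5 (by omega)
          refine ⟨rot (rot e), ?_, h8, h10.trans h7, ?_⟩
          · rwa [Perm.sameCycle_apply_right, Perm.sameCycle_apply_right]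
          · rw [h9, h6, h4, pow_succ', Perm.mul_apply]
      obtain ⟨e, h1, h2, h3, h4⟩ := step k
      rwa [← h.inj e d' (h4.trans hk) (h3.trans hl'.symm) (by simp [h2, hd'])]
    have red : ∀ d, lev d = i + 1 → ∃ e, rot.SameCycle d e ∧ out e ∧ lev e = i + 1 := by
      intro d hl
      by_cases hd : out d
      · exact ⟨d, .rfl, hd, hl⟩
      · obtain ⟨h8, h9, h10⟩ := h.rot_in d hd (by omega)
        exact ⟨rot d, Perm.sameCycle_apply_right.2 .rfl, h8, h10.trans hl⟩
    obtain ⟨e, h1, h2, h3⟩ := red d hi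
    obtain ⟨e', h1', h2', h3'⟩ := red d' (hl ▸ hi)
    exact (h1.trans (main e e' h2 h2' h3 h3')).trans h1'.symm

/-! ### Faces and cycles of the product -/

/-- Walking backward along a thread and through the factor met there does not change the symbol of
the source ahead. -/
theorem faceSymbol_walk_in {d : D} (hd : ¬ out d) :
    faceSymbol out f thr lev (rot (opp d)) = faceSymbol out f thr lev d := by
  have ho : out (opp d) := (h.out_opp d).2 hd
  have hlt := h.lev_lt _ ho
  have hgap := fun i => h.gap _ i ho
  rw [h.opp_opp] at hlt hgap
  have hx := h.thr_opp d
  rcases h.out_cases _ ho with h0 | ⟨i, hi, -⟩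
  · rw [h.rot_source _ ho h0]
    simp only [faceSymbol, ho, hd, if_true, if_false]
    rw [← hx, prod_take_of_fixed f (Nat.zero_le _) (fun k _ hk => hgap k (by omega) (by omega))]
    rfl
  · obtain ⟨h1, h2, h3⟩ := h.rot_out _ i ho hi
    simp only [faceSymbol, h1, hd, if_false, h2, h3, Nat.add_sub_cancel]
    rw [← hx, ← Perm.mul_apply, ← prod_take_succ]
    exact (prod_take_of_fixed f (by omega) (fun k _ hk => hgap k (by omega) (by omega))).symm

theorem faceSymbol_walk (d : D) :
    f.prod.SameCycle (faceSymbol out f thr lev (rot (opp d))) (faceSymbol out f thr lev d) := by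
  by_cases hd : out d
  · have ho : ¬ out (opp d) := by simpa [h.out_opp d] using hd
    by_cases hl : lev (opp d) = f.length + 1
    · rw [h.rot_sink _ ho hl, faceSymbol_sink ho hl, h.thr_opp, Perm.sameCycle_apply_left]
      simp [faceSymbol, hd, Perm.SameCycle.rfl]
    · obtain ⟨h1, h2, -⟩ := h.rot_in _ ho hl
      simp [faceSymbol, hd, h1, h2, h.thr_opp, Perm.SameCycle.rfl]
  · rw [h.faceSymbol_walk_in hd]

/-- The boundary walk to an outgoing dart runs along its thread from the source. -/
theorem exists_source_sameCycle_out (d : D) (hd : out d) :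
    ∃ s, out s ∧ lev s = 0 ∧ thr s = thr d ∧ (rot * opp).SameCycle s d := by
  induction hk : lev d using Nat.strong_induction_on generalizing d with
  | _ k ih =>
    subst hk
    by_cases h0 : lev d = 0
    · exact ⟨d, hd, h0, rfl, .rfl⟩
    obtain ⟨e, he, he1, he2, he3⟩ := h.exists_rot_eq_out hd h0
    have ho := (h.out_opp e).2 he1
    have hlt := h.lev_lt _ ho
    rw [h.opp_opp] at hlt
    obtain ⟨s, h1, h2, h3, h4⟩ := ih (lev (opp e)) (by omega) (opp e) ho rfl
    refine ⟨s, h1, h2, by rw [h3, h.thr_opp, he2], ?_⟩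
    have : (rot * opp) (opp e) = d := by rw [Perm.mul_apply, h.opp_opp, he]
    rwa [← this, Perm.sameCycle_apply_right]

theorem exists_source_sameCycle (d : D) :
    ∃ s, out s ∧ lev s = 0 ∧ thr s = faceSymbol out f thr lev d ∧ (rot * opp).SameCycle s d := by
  by_cases hd : out d
  · obtain ⟨s, h1, h2, h3, h4⟩ := h.exists_source_sameCycle_out d hd
    exact ⟨s, h1, h2, by simp [faceSymbol, hd, h3], h4⟩
  induction hk : lev d using Nat.strong_induction_on generalizing d with
  | _ k ih =>
    subst hk
    have ho := (h.out_opp d).2 hd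
    have hlt := h.lev_lt _ ho
    rw [h.opp_opp] at hlt
    rw [← h.faceSymbol_walk_in hd]
    simp only [← Perm.sameCycle_apply_right (y := d), Perm.mul_apply]
    rcases h.out_cases _ ho with h0 | ⟨i, hi, -⟩
    · rw [h.rot_source _ ho h0]
      exact ⟨opp d, ho, h0, by simp [faceSymbol, ho], .rfl⟩
    · obtain ⟨h1, h2, h3⟩ := h.rot_out _ i ho hi
      exact ih _ (by omega) _ h1 rfl

/-- The faces of the map correspond to the cycles of the product. -/
theorem sameCycle_face_iff [Finite D] (d d' : D) :
    (rot * opp).SameCycle d d' ↔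
      f.prod.SameCycle (faceSymbol out f thr lev d) (faceSymbol out f thr lev d') := by
  constructor
  · intro hs
    have := apply_eq_of_sameCycle (q := rot * opp)
      (F := fun d => Quotient.mk (Perm.SameCycle.setoid f.prod) (faceSymbol out f thr lev d))
      (fun x => Quotient.sound (h.faceSymbol_walk x)) hs
    exact Quotient.exact this
  · choose s hs using h.exists_source
    have hsrc : ∀ d, (rot * opp).SameCycle (s (faceSymbol out f thr lev d)) d := by
      intro d
      obtain ⟨e, h1, h2, h3, h4⟩ := h.exists_source_sameCycle d
      obtain ⟨h5, h6, h7⟩ := hs (faceSymbol out f thr lev d)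
      rwa [h.inj _ e (h6.trans h3.symm) (h7.trans h2.symm) (by simp [h5, h1])]
    have hnext : ∀ x, (rot * opp).SameCycle (s (f.prod x)) (s x) := by
      intro x
      obtain ⟨t, h1, h2, h3⟩ := h.exists_sink x
      have h4 := hsrc t
      rw [faceSymbol_sink h1 h3, h2] at h4
      have ho := (h.out_opp t).2 h1
      have h5 := hsrc (opp t)
      rw [faceSymbol, if_pos ho, h.thr_opp, h2] at h5
      have h6 : (rot * opp) (opp t) = t := by
        rw [Perm.mul_apply, h.opp_opp, h.rot_sink t h1 h3]
      rw [← h6, Perm.sameCycle_apply_right] at h4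
      exact h4.trans h5.symm
    intro hc
    have := apply_eq_of_sameCycle (q := f.prod)
      (F := fun x => Quotient.mk (Perm.SameCycle.setoid (rot * opp)) (s x))
      (fun x => Quotient.sound (hnext x)) hc
    exact ((hsrc d).symm.trans (Quotient.exact this)).trans (hsrc d')

/-! ### Connectedness and transitivity -/

/-- Sets of darts invariant under `rot` and `opp` are unions of threads, and correspond to the sets
of symbols invariant under the factors. -/
theorem isPretransitive_iff :
    MulAction.IsPretransitive (Subgroup.closure {rot, opp}) D ↔ IsTransitive f := by
  rw [IsTransitive, isPretransitive_closure_iff, isPretransitive_closure_iff]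
  choose s hs using h.exists_source
  have hs' : ∀ d, out d → lev d = 0 → s (thr d) = d := fun d h1 h2 =>
    h.inj _ _ (hs _).2.1 ((hs _).2.2.trans h2.symm) (by simp [(hs _).1, h1])
  constructor
  · intro H Q hQ x y hx
    have hfac : ∀ i z, Q (fac f i z) ↔ Q z := by
      intro i z
      rcases lt_or_ge i f.length with hi | hi
      · exact hQ _ (fac_mem f hi) z
      · simp [fac_of_le f hi]
    have := H (fun d => Q (thr d)) ?_ (s x) (s y) (by rwa [(hs x).2.1])
    · rwa [(hs y).2.1] at this
    · rintro g (rfl | rfl) d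
      · by_cases hd : out d
        · rcases h.out_cases d hd with h0 | ⟨i, hi, -⟩
          · rw [h.rot_source d hd h0]
          · rw [(h.rot_out d i hd hi).2.1, hfac]
        · by_cases hl : lev d = f.length + 1
          · rw [h.rot_sink d hd hl]
          · rw [(h.rot_in d hd hl).2.1]
      · rw [h.thr_opp]
  · intro H P hP d d' hd
    have hrot := hP rot (by simp)
    have hopp := hP opp (by simp)
    have hout : ∀ d, out d → (P d ↔ P (s (thr d))) := by
      intro d hd
      obtain ⟨e, h1, h2, h3, k, h4⟩ := h.exists_source_sameCycle_out d hd
      rw [← h3, hs' e h1 h2]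
      clear hd h3
      -- the boundary walk from the source to `d` preserves `P`
      have hk : ∀ k : ℤ, ∀ e, P (((rot * opp) ^ k) e) ↔ P e := by
        have h1 : ∀ e, P ((rot * opp) e) ↔ P e := fun e => by
          rw [Perm.mul_apply, hrot, hopp]
        intro k
        induction k using Int.induction_on with
        | zero => simp
        | succ k ih => intro e; rw [zpow_add_one, Perm.mul_apply, ih, h1]
        | pred k ih =>
          intro e
          rw [zpow_sub_one, Perm.mul_apply, ih, ← h1]
          simp
      rw [← h4, hk]
    have hall : ∀ d, P d ↔ P (s (thr d)) := by
      intro d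
      by_cases hd : out d
      · exact hout d hd
      · rw [← hopp, hout _ ((h.out_opp d).2 hd), h.thr_opp]
    rw [hall] at hd ⊢
    refine H (fun x => P (s x)) ?_ _ _ hd
    intro g hg x
    obtain ⟨i, hi, rfl⟩ := List.mem_iff_getElem.1 hg
    rw [← fac_of_lt f hi]
    by_cases hx : fac f i x = x
    · rw [hx]
    · obtain ⟨e, h1, h2, h3⟩ := h.exists_out x i hx
      have h4 := (h.rot_out e i h1 h3).2.1
      rw [← h2, ← hall, ← h4, ← hall, hrot]

end IsReading

/-! ### Vertices, edges, faces and degrees of a map with a reading -/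

theorem DirectedMap.vertexOf_eq_iff {M : DirectedMap} {d d' : M.Dart} :
    M.vertexOf d = M.vertexOf d' ↔ M.rot.SameCycle d d' :=
  ⟨fun h => Quotient.exact h, fun h => Quotient.sound h⟩

theorem DirectedMap.faceOf_eq_iff {M : DirectedMap} {d d' : M.Dart} :
    M.faceOf d = M.faceOf d' ↔ (M.rot * M.opp).SameCycle d d' :=
  ⟨fun h => Quotient.exact h, fun h => Quotient.sound h⟩

theorem DirectedMap.exists_vertexOf_eq {M : DirectedMap} (v : M.Vertex) :
    ∃ d, M.vertexOf d = v :=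
  Quotient.exists_rep v

theorem DirectedMap.exists_faceOf_eq {M : DirectedMap} (F : M.Face) : ∃ d, M.faceOf d = F :=
  Quotient.exists_rep F

theorem DirectedMap.vertexOf_rot {M : DirectedMap} (d : M.Dart) :
    M.vertexOf (M.rot d) = M.vertexOf d :=
  vertexOf_eq_iff.2 (Perm.sameCycle_apply_left.2 .rfl)

/-- Positions of a list carrying an entry of weight `k`, counted as a type. -/
theorem natCard_getElem_eq_count {X : Type*} (l : List X) (w : X → ℕ) (k : ℕ) :
    Nat.card {i : Fin l.length // w l[i.1] = k} = (l.map w).count k := by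
  rw [Nat.card_eq_fintype_card, Fintype.card_subtype, Finset.card_filter,
    Fin.sum_univ_fun_getElem l (fun s => if w s = k then 1 else 0)]
  induction l with
  | nil => simp
  | cons a l ih =>
    rw [List.map_cons, List.map_cons, List.sum_cons, List.count_cons, ih, add_comm]
    simp

open Classical in
theorem DirectedMap.card_edge (M : DirectedMap) :
    Nat.card M.Edge = Nat.card {d // M.IsOut d} := by
  let F : M.Dart → {d // M.IsOut d} := fun d =>
    if hd : M.IsOut d then ⟨d, hd⟩ else ⟨M.opp d, (M.isOut_opp d).2 hd⟩
  have hF : ∀ d, (F d).1 = d ∨ (F d).1 = M.opp d := by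
    intro d
    by_cases hd : M.IsOut d <;> simp [F, hd]
  refine natCard_quotient_eq _ F (fun d => ⟨d.1, by simp [F, d.2]⟩) fun d d' => ?_
  change _ ↔ M.opp.SameCycle d d'
  have hFs : ∀ d, M.opp.SameCycle d (F d).1 := by
    intro d
    rcases hF d with h1 | h1 <;> rw [h1]
    exact Perm.sameCycle_apply_right.2 .rfl
  constructor
  · intro h1
    exact (hFs d).trans (h1 ▸ (hFs d').symm)
  · refine apply_eq_of_sameCycle fun x => ?_
    by_cases hx : M.IsOut x
    · have : ¬ M.IsOut (M.opp x) := by rwa [M.isOut_opp, not_not]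
      simp [F, hx, this, M.opp_opp]
    · have : M.IsOut (M.opp x) := by rwa [M.isOut_opp]
      simp [F, hx, this]

namespace IsReading

variable {M : DirectedMap} {n : ℕ} {f : List (Perm (Fin n))} {thr : M.Dart → Fin n}
  {lev : M.Dart → ℕ} (h : IsReading M.rot M.opp M.IsOut f thr lev)
include h

theorem isOut_of_lev_eq_zero {d : M.Dart} (hl : lev d = 0) : M.IsOut d := by
  by_contra hd
  have := h.lev_pos_of_in hd
  omega

theorem not_isOut_of_lev_eq {d : M.Dart} (hl : lev d = f.length + 1) : ¬ M.IsOut d := by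
  intro hd
  have := h.lev_le_of_out hd
  omega

theorem level_cases (d : M.Dart) :
    lev d = 0 ∨ lev d = f.length + 1 ∨ ∃ i, i < f.length ∧ lev d = i + 1 := by
  have := h.lev_le d
  by_cases h0 : lev d = 0
  · exact .inl h0
  by_cases h1 : lev d = f.length + 1
  · exact .inr (.inl h1)
  · exact .inr (.inr ⟨lev d - 1, by omega, by omega⟩)

theorem vertexOf_eq_iff (hf : ∀ s ∈ f, s.IsCycle) {d d' : M.Dart} :
    M.vertexOf d = M.vertexOf d' ↔
      lev d = lev d' ∧ (lev d = 0 ∨ lev d = f.length + 1 → thr d = thr d') := by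
  rw [DirectedMap.vertexOf_eq_iff, h.sameCycle_rot_iff hf]

theorem card_vertex (hf : ∀ s ∈ f, s.IsCycle) : Nat.card M.Vertex = 2 * n + f.length := by
  let F : M.Dart → Fin n ⊕ (Fin f.length ⊕ Fin n) := fun d =>
    if lev d = 0 then .inl (thr d) else
      if hd : lev d - 1 < f.length then .inr (.inl ⟨lev d - 1, hd⟩) else .inr (.inr (thr d))
  have hF : ∀ d d', F d = F d' ↔ Perm.SameCycle.setoid M.rot d d' := by
    intro d d'
    change _ ↔ M.rot.SameCycle d d'
    rw [h.sameCycle_rot_iff hf]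
    rcases h.level_cases d with h0 | h0 | ⟨i, hi, h0⟩ <;>
      rcases h.level_cases d' with h0' | h0' | ⟨i', hi', h0'⟩
    · simp [F, h0, h0']
    · simp [F, h0, h0']
    · simp [F, h0, h0', hi']
    · simp [F, h0, h0']
    · simp [F, h0, h0']
    · simp [F, h0, h0', hi']
      omega
    · simp [F, h0, h0', hi]
    · simp [F, h0, h0', hi]
      omega
    · simp [F, h0, h0', hi, hi']
      omega
  have hs : Function.Surjective F := by
    rintro (x | ⟨i, hi⟩ | x)
    · obtain ⟨d, -, h1, h2⟩ := h.exists_source x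
      exact ⟨d, by simp [F, h1, h2]⟩
    · obtain ⟨x, hx⟩ := exists_fac_ne hf hi
      obtain ⟨d, -, h1, h2⟩ := h.exists_out x i hx
      exact ⟨d, by simp [F, h2, hi]⟩
    · obtain ⟨d, -, h1, h2⟩ := h.exists_sink x
      exact ⟨d, by simp [F, h1, h2]⟩
  rw [DirectedMap.Vertex, natCard_quotient_eq _ F hs hF]
  simp only [Nat.card_eq_fintype_card, Fintype.card_sum, Fintype.card_fin]
  omega

/-- Each edge is represented by its outgoing dart, which starts at a source or at the crossing of a
thread with a factor. -/
theorem card_isOut : Nat.card {d // M.IsOut d} = n + (f.map fun s => s.support.card).sum := by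
  let G : {d // M.IsOut d} → Fin n ⊕ (Σ i : Fin f.length, {x // x ∈ (f[i.1]).support}) := fun d =>
    if hd : ∃ i : Fin f.length, lev d.1 = i.1 + 1 then .inr ⟨hd.choose, thr d.1, by
      rw [Perm.mem_support, ← fac_of_lt]
      exact h.moved hd.choose_spec hd.choose.2⟩ else .inl (thr d.1)
  have hG : ∀ (d : {d // M.IsOut d}) (i : Fin f.length) (hi : lev d.1 = i.1 + 1),
      G d = .inr ⟨i, thr d.1, by
        rw [Perm.mem_support, ← fac_of_lt]
        exact h.moved hi i.2⟩ := by
    intro d i hi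
    have hd : ∃ i : Fin f.length, lev d.1 = i.1 + 1 := ⟨i, hi⟩
    have hc : hd.choose = i := by
      have := hd.choose_spec
      exact Fin.ext (by omega)
    have key : ∀ (j : Fin f.length) (_ : j = i) (hj : thr d.1 ∈ (f[j.1]).support)
        (hi : thr d.1 ∈ (f[i.1]).support),
        (Sum.inr ⟨j, thr d.1, hj⟩ : Fin n ⊕ (Σ i : Fin f.length, {x // x ∈ (f[i.1]).support})) =
          .inr ⟨i, thr d.1, hi⟩ := by
      rintro j rfl _ _
      rfl
    simp only [G, hd, dif_pos]
    exact key _ hc _ _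
  have hG' : ∀ d : {d // M.IsOut d}, lev d.1 = 0 → G d = .inl (thr d.1) := by
    intro d h0
    have hd : ¬ ∃ i : Fin f.length, lev d.1 = i.1 + 1 := by
      rintro ⟨i, hi⟩
      omega
    simp only [G, hd, dif_neg, not_false_eq_true]
  have hc : ∀ d : {d // M.IsOut d}, lev d.1 = 0 ∨ ∃ i : Fin f.length, lev d.1 = i.1 + 1 := by
    intro d
    rcases h.out_cases d.1 d.2 with h0 | ⟨i, hi, hx⟩
    · exact .inl h0
    · exact .inr ⟨⟨i, lt_of_fac_ne f hx⟩, hi⟩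
  have hbij : Function.Bijective G := by
    constructor
    · intro d d' hdd
      rcases hc d with h0 | ⟨i, hi⟩ <;> rcases hc d' with h0' | ⟨i', hi'⟩
      · rw [hG' d h0, hG' d' h0', Sum.inl.injEq] at hdd
        exact Subtype.ext (h.inj _ _ hdd (h0.trans h0'.symm) (by simp [d.2, d'.2]))
      · rw [hG' d h0, hG d' i' hi'] at hdd
        cases hdd
      · rw [hG' d' h0', hG d i hi] at hdd
        cases hdd
      · rw [hG d i hi, hG d' i' hi', Sum.inr.injEq] at hdd
        have h1 : i = i' := congrArg Sigma.fst hdd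
        subst h1
        have h2 : thr d.1 = thr d'.1 := by
          simpa using hdd
        exact Subtype.ext (h.inj _ _ h2 (hi.trans hi'.symm) (by simp [d.2, d'.2]))
    · rintro (x | ⟨i, x, hx⟩)
      · obtain ⟨d, h1, h2, h3⟩ := h.exists_source x
        exact ⟨⟨d, h1⟩, by rw [hG' _ h3, h2]⟩
      · have hx' : fac f i x ≠ x := by
          rw [fac_of_lt f i.2]
          exact Perm.mem_support.1 hx
        obtain ⟨d, h1, h2, h3⟩ := h.exists_out x i hx'
        refine ⟨⟨d, h1⟩, ?_⟩
        rw [hG _ i h3]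
        simp only [h2]
  rw [Nat.card_congr (Equiv.ofBijective G hbij)]
  simp only [Nat.card_eq_fintype_card, Fintype.card_sum, Fintype.card_fin, Fintype.card_sigma,
    Fintype.card_coe]
  rw [Fin.sum_univ_fun_getElem f (fun s => s.support.card)]

theorem faceOf_eq_iff {d d' : M.Dart} : M.faceOf d = M.faceOf d' ↔
    f.prod.SameCycle (faceSymbol M.IsOut f thr lev d) (faceSymbol M.IsOut f thr lev d') := by
  rw [DirectedMap.faceOf_eq_iff, h.sameCycle_face_iff]

theorem card_face {m : ℕ} (c : Fin n → Fin m) (hc : ∀ x y, c x = c y ↔ f.prod.SameCycle x y)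
    (hs : Function.Surjective c) : Nat.card M.Face = m := by
  have := natCard_quotient_eq (Perm.SameCycle.setoid M.facePerm)
    (fun d => c (faceSymbol M.IsOut f thr lev d)) (fun i => by
      obtain ⟨x, rfl⟩ := hs i
      obtain ⟨d, h1, h2, -⟩ := h.exists_source x
      exact ⟨d, by simp [faceSymbol, h1, h2]⟩) (fun d d' => by
      rw [hc]
      exact (h.sameCycle_face_iff d d').symm)
  simpa [DirectedMap.Face] using this

/-- Euler's formula: there are `2 n + r` vertices, one edge for every symbol and for every symbol moved
by a factor, and one face for every cycle of the product. -/
theorem hasGenus_iff (hf : ∀ s ∈ f, s.IsCycle) {m : ℕ} (c : Fin n → Fin m)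
    (hc : ∀ x y, c x = c y ↔ f.prod.SameCycle x y) (hs : Function.Surjective c)
    (hm : numCycles f.prod = m) (g : ℕ) : M.HasGenus g ↔ HasGenus f g := by
  have htr : IsTransitive f := h.isPretransitive_iff.1 M.connected
  rw [DirectedMap.HasGenus, HasGenus, h.card_vertex hf, h.card_face c hc hs, M.card_edge,
    h.card_isOut, ← depth_add_length f hf, hm]
  simp only [htr, true_and]
  omega

theorem degree_inner (hf : ∀ s ∈ f, s.IsCycle) {d : M.Dart} {i : ℕ} (hi : i < f.length)
    (hl : lev d = i + 1) : M.degree (M.vertexOf d) = 2 * (fac f i).support.card := by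
  classical
  have hlev : ∀ e, M.vertexOf e = M.vertexOf d ↔ lev e = i + 1 := by
    intro e
    rw [h.vertexOf_eq_iff hf, hl]
    simp only [and_iff_left_iff_imp]
    intro h1 h2
    omega
  let G : {e // M.vertexOf e = M.vertexOf d} → {x // x ∈ (fac f i).support} × Bool := fun e =>
    (⟨thr e.1, Perm.mem_support.2 (h.moved ((hlev _).1 e.2) hi)⟩, decide (M.IsOut e.1))
  have hG : Function.Bijective G := by
    constructor
    · rintro ⟨e, he⟩ ⟨e', he'⟩ hee
      simp only [G, Prod.mk.injEq, Subtype.mk.injEq, decide_eq_decide] at hee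
      exact Subtype.ext (h.inj _ _ hee.1 (((hlev _).1 he).trans ((hlev _).1 he').symm) hee.2)
    · rintro ⟨⟨x, hx⟩, b⟩
      cases b
      · obtain ⟨e, h1, h2, h3⟩ := h.exists_in x i (Perm.mem_support.1 hx)
        exact ⟨⟨e, (hlev e).2 h3⟩, by simp [G, h1, h2]⟩
      · obtain ⟨e, h1, h2, h3⟩ := h.exists_out x i (Perm.mem_support.1 hx)
        exact ⟨⟨e, (hlev e).2 h3⟩, by simp [G, h1, h2]⟩
  rw [DirectedMap.degree, Nat.card_congr (Equiv.ofBijective G hG)]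
  simp only [Nat.card_eq_fintype_card, Fintype.card_prod, Fintype.card_coe, Fintype.card_bool,
    mul_comm]

theorem vertexOf_eq_iff_of_outer {d e : M.Dart} (hl : lev d = 0 ∨ lev d = f.length + 1) :
    M.vertexOf e = M.vertexOf d ↔ e = d := by
  rw [DirectedMap.vertexOf_eq_iff]
  refine ⟨fun hs => hs.eq_of_right ((h.rot_eq_self_iff d).2 hl), ?_⟩
  rintro rfl
  exact .rfl

theorem degree_outer {d : M.Dart} (hl : lev d = 0 ∨ lev d = f.length + 1) :
    M.degree (M.vertexOf d) = 1 := by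
  rw [DirectedMap.degree, Nat.card_eq_one_iff_unique]
  refine ⟨⟨fun e e' => Subtype.ext ?_⟩, ⟨⟨d, rfl⟩⟩⟩
  rw [(h.vertexOf_eq_iff_of_outer hl).1 e.2, (h.vertexOf_eq_iff_of_outer hl).1 e'.2]

theorem isSource_iff {d : M.Dart} : M.IsSource (M.vertexOf d) ↔ lev d = 0 := by
  constructor
  · intro hs
    rcases h.level_cases d with h0 | h0 | ⟨i, hi, h0⟩
    · exact h0
    · exact absurd (hs d rfl) (h.not_isOut_of_lev_eq h0)
    · exact absurd (hs _ (M.vertexOf_rot d)) (h.rot_out d i (hs d rfl) h0).1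
  · intro hl e he
    rw [(h.vertexOf_eq_iff_of_outer (.inl hl)).1 he]
    exact h.isOut_of_lev_eq_zero hl

theorem isSink_iff {d : M.Dart} : M.IsSink (M.vertexOf d) ↔ lev d = f.length + 1 := by
  constructor
  · intro hs
    by_contra hl
    exact hs _ (M.vertexOf_rot d) (h.rot_in d (hs d rfl) hl).1
  · intro hl e he
    rw [(h.vertexOf_eq_iff_of_outer (.inr hl)).1 he]
    exact h.not_isOut_of_lev_eq hl

theorem card_degree_eq (hf : ∀ s ∈ f, s.IsCycle) {k : ℕ} (hk : 2 ≤ k) :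
    Nat.card {v : M.Vertex // M.degree v = 2 * k} = signature f k := by
  rw [signature_eq_count f hf, ← natCard_getElem_eq_count]
  have hex : ∀ i : Fin f.length, ∃ d, lev d = i.1 + 1 := by
    intro i
    obtain ⟨x, hx⟩ := exists_fac_ne hf i.2
    obtain ⟨d, -, -, hd⟩ := h.exists_out x i hx
    exact ⟨d, hd⟩
  choose d hd using hex
  symm
  refine Nat.card_congr (Equiv.ofBijective (fun i => ⟨M.vertexOf (d i.1), ?_⟩) ⟨?_, ?_⟩)
  · rw [h.degree_inner hf i.1.2 (hd i.1), fac_of_lt f i.1.2, i.2]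
  · intro i j hij
    have := ((h.vertexOf_eq_iff hf).1 (congrArg Subtype.val hij)).1
    rw [hd, hd] at this
    exact Subtype.ext (Fin.ext (by omega))
  · rintro ⟨v, hv⟩
    obtain ⟨e, rfl⟩ := DirectedMap.exists_vertexOf_eq v
    rcases h.level_cases e with h0 | h0 | ⟨i, hi, h0⟩
    · rw [h.degree_outer (.inl h0)] at hv
      omega
    · rw [h.degree_outer (.inr h0)] at hv
      omega
    · have hv' := hv
      rw [h.degree_inner hf hi h0, fac_of_lt f hi] at hv'
      refine ⟨⟨⟨i, hi⟩, by simpa using hv'⟩, Subtype.ext ?_⟩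
      rw [h.vertexOf_eq_iff hf, hd, h0]
      refine ⟨rfl, fun h1 => ?_⟩
      simp only at h1
      omega

/-- The sources in a face are those of the symbols in the corresponding cycle of the product. -/
theorem card_source (d₀ : M.Dart) :
    Nat.card {v : M.Vertex // M.IsSource v ∧ M.Incident v (M.faceOf d₀)} =
      Nat.card {x // f.prod.SameCycle x (faceSymbol M.IsOut f thr lev d₀)} := by
  choose s hs using h.exists_source
  have hface : ∀ x, M.faceOf (s x) = M.faceOf d₀ ↔
      f.prod.SameCycle x (faceSymbol M.IsOut f thr lev d₀) := fun x => by
    rw [h.faceOf_eq_iff]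
    simp [faceSymbol, (hs x).1, (hs x).2.1]
  symm
  refine Nat.card_congr (Equiv.ofBijective (fun x => ⟨M.vertexOf (s x.1),
    h.isSource_iff.2 (hs _).2.2, s x.1, rfl, (hface _).2 x.2⟩) ⟨?_, ?_⟩)
  · intro x y hxy
    have := (h.vertexOf_eq_iff_of_outer (.inl (hs y.1).2.2)).1 (congrArg Subtype.val hxy)
    exact Subtype.ext (by rw [← (hs x.1).2.1, this, (hs y.1).2.1])
  · rintro ⟨v, hv, d, rfl, hd⟩
    rw [h.isSource_iff] at hv
    obtain ⟨h1, h2, h3⟩ := hs (thr d)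
    have hsd : s (thr d) = d :=
      h.inj _ _ h2 (h3.trans hv.symm) (by simp [h1, h.isOut_of_lev_eq_zero hv])
    refine ⟨⟨thr d, (hface _).1 (hsd.symm ▸ hd)⟩, Subtype.ext ?_⟩
    simp only [hsd]

/-- The sinks in a face are those of the symbols in the corresponding cycle of the product. -/
theorem card_sink (d₀ : M.Dart) :
    Nat.card {v : M.Vertex // M.IsSink v ∧ M.Incident v (M.faceOf d₀)} =
      Nat.card {x // f.prod.SameCycle x (faceSymbol M.IsOut f thr lev d₀)} := by
  choose s hs using h.exists_sink
  have hface : ∀ x, M.faceOf (s x) = M.faceOf d₀ ↔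
      f.prod.SameCycle x (faceSymbol M.IsOut f thr lev d₀) := fun x => by
    rw [h.faceOf_eq_iff, faceSymbol_sink (hs x).1 (hs x).2.2, (hs x).2.1,
      Perm.sameCycle_apply_left]
  symm
  refine Nat.card_congr (Equiv.ofBijective (fun x => ⟨M.vertexOf (s x.1),
    h.isSink_iff.2 (hs _).2.2, s x.1, rfl, (hface _).2 x.2⟩) ⟨?_, ?_⟩)
  · intro x y hxy
    have := (h.vertexOf_eq_iff_of_outer (.inr (hs y.1).2.2)).1 (congrArg Subtype.val hxy)
    exact Subtype.ext (by rw [← (hs x.1).2.1, this, (hs y.1).2.1])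
  · rintro ⟨v, hv, d, rfl, hd⟩
    rw [h.isSink_iff] at hv
    obtain ⟨h1, h2, h3⟩ := hs (thr d)
    have hsd : s (thr d) = d :=
      h.inj _ _ h2 (h3.trans hv.symm) (by simp [h1, h.not_isOut_of_lev_eq hv])
    refine ⟨⟨thr d, (hface _).1 (hsd.symm ▸ hd)⟩, Subtype.ext ?_⟩
    simp only [hsd]

theorem isAlternating : M.IsAlternating := by
  intro d hd
  rw [Ne, h.rot_eq_self_iff] at hd
  push Not at hd
  by_cases ho : M.IsOut d
  · rcases h.out_cases d ho with h0 | ⟨i, hi, -⟩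
    · exact absurd h0 hd.1
    · simp [ho, (h.rot_out d i ho hi).1]
  · simp [ho, (h.rot_in d ho hd.2).1]

theorem lev_eq_of_vertexOf_eq {d d' : M.Dart} (hd : M.vertexOf d = M.vertexOf d') :
    lev d = lev d' :=
  apply_eq_of_sameCycle h.lev_rot (DirectedMap.vertexOf_eq_iff.1 hd)

theorem isAcyclic : M.IsAcyclic := by
  have key : ∀ u v, Relation.TransGen M.Arc u v → ∀ d d', M.vertexOf d = u → M.vertexOf d' = v →
      lev d < lev d' := by
    intro u v huv
    induction huv with
    | single ha =>
      obtain ⟨e, h1, h2, h3⟩ := ha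
      intro d d' hd hd'
      rw [h.lev_eq_of_vertexOf_eq (hd.trans h2.symm), h.lev_eq_of_vertexOf_eq (hd'.trans h3.symm)]
      exact h.lev_lt e h1
    | tail _ ha ih =>
      obtain ⟨e, h1, h2, h3⟩ := ha
      intro d d' hd hd'
      rw [h.lev_eq_of_vertexOf_eq (hd'.trans h3.symm)]
      exact (ih d e hd h2).trans (h.lev_lt e h1)
  intro v hv
  obtain ⟨d, hd⟩ := DirectedMap.exists_vertexOf_eq v
  exact lt_irrefl _ (key v v hv d d hd hd)

theorem vertex_cases (hf : ∀ s ∈ f, s.IsCycle) (v : M.Vertex) :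
    M.IsSource v ∨ M.IsSink v ∨ (Even (M.degree v) ∧ 4 ≤ M.degree v) := by
  obtain ⟨d, rfl⟩ := DirectedMap.exists_vertexOf_eq v
  rcases h.level_cases d with h0 | h0 | ⟨i, hi, h0⟩
  · exact .inl (h.isSource_iff.2 h0)
  · exact .inr (.inl (h.isSink_iff.2 h0))
  · have := (hf _ (fac_mem f hi)).two_le_card_support
    rw [h.degree_inner hf hi h0]
    exact .inr (.inr ⟨even_two_mul _, by omega⟩)

end IsReading

/-! ### Sources and sinks by level -/

namespace IsReading

variable {n : ℕ} {f f' : List (Perm (Fin n))}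

section Raw

variable {D : Type} {rot opp : Perm D} {out : D → Prop} {thr : D → Fin n} {lev : D → ℕ}

theorem lev_eq_zero_iff (h : IsReading rot opp out f thr lev) {d : D} :
    lev d = 0 ↔ out d ∧ rot d = d := by
  rw [h.rot_eq_self_iff]
  constructor
  · intro h0
    refine ⟨?_, .inl h0⟩
    by_contra hd
    have := h.lev_pos_of_in hd
    omega
  · rintro ⟨hd, h0⟩
    have := h.lev_le_of_out hd
    omega

theorem lev_eq_length_add_one_iff (h : IsReading rot opp out f thr lev) {d : D} :
    lev d = f.length + 1 ↔ ¬ out d ∧ rot d = d := by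
  rw [h.rot_eq_self_iff]
  constructor
  · intro h0
    refine ⟨?_, .inr h0⟩
    intro hd
    have := h.lev_le_of_out hd
    omega
  · rintro ⟨hd, h0⟩
    have := h.lev_pos_of_in hd
    omega

/-! ### Change of a reading under conjugation and under interchange of disjoint factors -/

/-- Relabelling the threads by `t` conjugates all factors by `t`. -/
theorem conj (h : IsReading rot opp out f thr lev) (t : Perm (Fin n)) :
    IsReading rot opp out (f.map fun s => t * s * t⁻¹) (fun d => t (thr d)) lev := by
  have hfac : ∀ i, fac (f.map fun s => t * s * t⁻¹) i = t * fac f i * t⁻¹ := by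
    intro i
    rcases lt_or_ge i f.length with hi | hi
    · rw [fac_of_lt _ (by simpa using hi), fac_of_lt _ hi, List.getElem_map]
    · rw [fac_of_le _ (by simpa using hi), fac_of_le _ hi]
      simp
  have hne : ∀ i x, fac f i x ≠ x → fac (f.map fun s => t * s * t⁻¹) i (t x) ≠ t x := by
    intro i x hx
    simpa [hfac] using hx
  exact
    { opp_opp := h.opp_opp
      out_opp := h.out_opp
      inj := fun d d' h1 => h.inj d d' (t.injective h1)
      exists_source := fun x => by
        obtain ⟨d, h1, h2, h3⟩ := h.exists_source (t⁻¹ x)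
        exact ⟨d, h1, by simp [h2], h3⟩
      exists_sink := fun x => by
        obtain ⟨d, h1, h2, h3⟩ := h.exists_sink (t⁻¹ x)
        exact ⟨d, h1, by simp [h2], by simpa using h3⟩
      exists_out := fun x i hx => by
        obtain ⟨d, h1, h2, h3⟩ := h.exists_out (t⁻¹ x) i (by
          intro hc
          apply hx
          rw [hfac, Perm.mul_apply, Perm.mul_apply, hc]
          simp)
        exact ⟨d, h1, by simp [h2], h3⟩
      out_cases := fun d hd => (h.out_cases d hd).imp id
        fun ⟨i, hi, hx⟩ => ⟨i, hi, hne i _ hx⟩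
      in_cases := fun d hd => (h.in_cases d hd).imp (by simp)
        fun ⟨i, hi, hx⟩ => ⟨i, hi, hne i _ hx⟩
      rot_source := h.rot_source
      rot_sink := fun d hd hl => h.rot_sink d hd (by simpa using hl)
      rot_out := fun d i hd hi => by
        obtain ⟨h1, h2, h3⟩ := h.rot_out d i hd hi
        exact ⟨h1, by simp [hfac, h2], h3⟩
      rot_in := fun d hd hl => by
        obtain ⟨h1, h2, h3⟩ := h.rot_in d hd (by simpa using hl)
        exact ⟨h1, by rw [h2], h3⟩
      thr_opp := fun d => by rw [h.thr_opp]
      lev_lt := h.lev_lt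
      gap := fun d i hd h1 h2 => by simp [hfac, h.gap d i hd h1 h2] }

/-- Interchanging the disjoint factors number `k` and `k + 1` amounts to interchanging two levels
of the map. -/
theorem swap_levels (h : IsReading rot opp out f thr lev) {k : ℕ} (hlen : f'.length = f.length)
    (hk : k + 1 < f.length) (h0 : fac f' k = fac f (k + 1)) (h1 : fac f' (k + 1) = fac f k)
    (hother : ∀ i, i ≠ k → i ≠ k + 1 → fac f' i = fac f i)
    (hdisj : ∀ x, fac f k x = x ∨ fac f (k + 1) x = x) :
    IsReading rot opp out f' thr (fun d => swap (k + 1) (k + 2) (lev d)) := by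
  let sw : ℕ → ℕ := swap (k + 1) (k + 2)
  have sw1 : sw (k + 1) = k + 2 := swap_apply_left _ _
  have sw2 : sw (k + 2) = k + 1 := swap_apply_right _ _
  have sw3 : ∀ l, l ≠ k + 1 → l ≠ k + 2 → sw l = l := fun l => swap_apply_of_ne_of_ne
  have swcases : ∀ l, (l = k + 1 ∧ sw l = k + 2) ∨ (l = k + 2 ∧ sw l = k + 1) ∨
      (l ≠ k + 1 ∧ l ≠ k + 2 ∧ sw l = l) := by
    intro l
    by_cases h1 : l = k + 1
    · exact .inl ⟨h1, h1 ▸ sw1⟩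
    by_cases h2 : l = k + 2
    · exact .inr (.inl ⟨h2, h2 ▸ sw2⟩)
    · exact .inr (.inr ⟨h1, h2, sw3 l h1 h2⟩)
  -- the factor at a new level is the factor at the corresponding old level
  have hfac : ∀ i j, sw (i + 1) = j + 1 → fac f' j = fac f i := by
    intro i j hij
    rcases swcases (i + 1) with ⟨h2, h3⟩ | ⟨h2, h3⟩ | ⟨h2, h3, h4⟩
    · obtain rfl : i = k := by omega
      obtain rfl : j = i + 1 := by omega
      exact h1
    · obtain rfl : i = k + 1 := by omega
      obtain rfl : j = k := by omega
      exact h0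
    · obtain rfl : i = j := by omega
      exact hother i (by omega) (by omega)
  have hsw0 : ∀ l, sw l = 0 ↔ l = 0 := by
    intro l
    rcases swcases l with ⟨h2, h3⟩ | ⟨h2, h3⟩ | ⟨h2, h3, h4⟩ <;> omega
  have hswr : ∀ l, sw l = f'.length + 1 ↔ l = f.length + 1 := by
    intro l
    rcases swcases l with ⟨h2, h3⟩ | ⟨h2, h3⟩ | ⟨h2, h3, h4⟩ <;> omega
  have hsucc : ∀ i, ∃ j, sw (i + 1) = j + 1 := by
    intro i
    rcases swcases (i + 1) with ⟨h2, h3⟩ | ⟨h2, h3⟩ | ⟨h2, h3, h4⟩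
    exacts [⟨_, h3⟩, ⟨_, h3⟩, ⟨_, h4⟩]
  have hinv : ∀ l, sw (sw l) = l := fun l => swap_apply_self _ _ _
  -- both levels cannot carry the same thread
  have hmeet : ∀ d e, thr d = thr e → lev d = k + 1 → lev e = k + 2 → False := by
    intro d e hde hd he
    have h2 := h.moved hd (by omega)
    have h3 := h.moved (i := k + 1) he (by omega)
    rw [← hde] at h3
    exact (hdisj (thr d)).elim h2 h3
  exact
    { opp_opp := h.opp_opp
      out_opp := h.out_opp
      inj := fun d d' h2 h3 => h.inj d d' h2 ((swap _ _).injective h3)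
      exists_source := fun x => by
        obtain ⟨d, h2, h3, h4⟩ := h.exists_source x
        exact ⟨d, h2, h3, (hsw0 _).2 h4⟩
      exists_sink := fun x => by
        obtain ⟨d, h2, h3, h4⟩ := h.exists_sink x
        exact ⟨d, h2, h3, (hswr _).2 h4⟩
      exists_out := fun x i hx => by
        obtain ⟨j, hj⟩ := hsucc i
        rw [hfac j i (by rw [← hj, hinv])] at hx
        obtain ⟨d, h2, h3, h4⟩ := h.exists_out x j hx
        exact ⟨d, h2, h3, by change sw (lev d) = _; rw [h4, ← hj, hinv]⟩
      out_cases := fun d hd => (h.out_cases d hd).imp (hsw0 _).2 fun ⟨i, hi, hx⟩ => by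
        obtain ⟨j, hj⟩ := hsucc i
        exact ⟨j, by rw [hi]; exact hj, by rwa [hfac i j hj]⟩
      in_cases := fun d hd => (h.in_cases d hd).imp (hswr _).2 fun ⟨i, hi, hx⟩ => by
        obtain ⟨j, hj⟩ := hsucc i
        exact ⟨j, by rw [hi]; exact hj, by rwa [hfac i j hj]⟩
      rot_source := fun d hd hl => h.rot_source d hd ((hsw0 _).1 hl)
      rot_sink := fun d hd hl => h.rot_sink d hd ((hswr _).1 hl)
      rot_out := fun d i hd hi => by
        obtain ⟨j, hj⟩ := hsucc i
        have hl : lev d = j + 1 := by rw [← hj, ← hi]; exact (hinv _).symm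
        obtain ⟨h2, h3, h4⟩ := h.rot_out d j hd hl
        refine ⟨h2, ?_, ?_⟩
        · rw [h3, hfac j i (by rw [← hj, hinv])]
        · change sw (lev (rot d)) = _
          rw [h4, ← hj, hinv]
      rot_in := fun d hd hl => by
        obtain ⟨h2, h3, h4⟩ := h.rot_in d hd fun h5 => hl ((hswr _).2 h5)
        exact ⟨h2, h3, congrArg sw h4⟩
      thr_opp := h.thr_opp
      lev_lt := fun d hd => by
        change sw (lev d) < sw (lev (opp d))
        have h2 := h.lev_lt d hd
        have h3 := hmeet d (opp d) (h.thr_opp d).symm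
        rcases swcases (lev d) with ⟨h4, h5⟩ | ⟨h4, h5⟩ | ⟨h4, h4', h5⟩ <;>
          rcases swcases (lev (opp d)) with ⟨h6, h7⟩ | ⟨h6, h7⟩ | ⟨h6, h6', h7⟩ <;>
          first | exact (h3 h4 h6).elim | omega
      gap := fun d i hd h2 h3 => by
        change sw (lev d) < i + 1 at h2
        change i + 1 < sw (lev (opp d)) at h3
        obtain ⟨j, hj⟩ := hsucc i
        rw [hfac j i (by rw [← hj, hinv])]
        have hlt := h.lev_lt d hd
        by_contra hx
        obtain ⟨e, he1, he2, he3⟩ := h.exists_out _ _ hx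
        have hg : ¬ (lev d < j + 1 ∧ j + 1 < lev (opp d)) := fun hc => hx (h.gap d j hd hc.1 hc.2)
        have h4 := hmeet d e he2.symm
        have h5 := hmeet e d he2
        have h6 := hmeet (opp d) e ((h.thr_opp d).trans he2.symm)
        have h7 := hmeet e (opp d) (he2.trans (h.thr_opp d).symm)
        have hj' : sw (j + 1) = i + 1 := by rw [← hj, hinv]
        rcases swcases (lev d) with ⟨a1, a2⟩ | ⟨a1, a2⟩ | ⟨a1, a1', a2⟩ <;>
          rcases swcases (lev (opp d)) with ⟨b1, b2⟩ | ⟨b1, b2⟩ | ⟨b1, b1', b2⟩ <;>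
          rcases swcases (j + 1) with ⟨c1, c2⟩ | ⟨c1, c2⟩ | ⟨c1, c1', c2⟩ <;>
          first
          | exact h4 a1 (he3.trans c1)
          | exact h5 (he3.trans c1) a1
          | exact h6 b1 (he3.trans c1)
          | exact h7 (he3.trans c1) b1
          | omega }

theorem swapStep (h : IsReading rot opp out f thr lev) (hs : SwapStep f f') :
    ∃ lev' : D → ℕ, IsReading rot opp out f' thr lev' ∧ ∀ d, lev' d = 0 ↔ lev d = 0 := by
  obtain ⟨l₁, l₂, a, b, hab, rfl, rfl⟩ := hs
  obtain ⟨e1, e2⟩ := fac_append_cons l₁ l₂ a b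
  obtain ⟨e3, e4⟩ := fac_append_cons l₁ l₂ b a
  refine ⟨_, h.swap_levels (k := l₁.length) (by simp) (by simp) (by rw [e2, e3]) (by rw [e1, e4])
    ?_ (fun x => by rw [e1, e2]; exact hab x), fun d => ?_⟩
  · intro i h1 h2
    simp only [fac, List.getD_eq_getElem?_getD]
    rcases lt_or_ge i l₁.length with hi | hi
    · rw [List.getElem?_append_left hi, List.getElem?_append_left hi]
    · obtain ⟨j, hj⟩ : ∃ j, i - l₁.length = j + 2 := ⟨i - l₁.length - 2, by omega⟩
      rw [List.getElem?_append_right hi, List.getElem?_append_right hi, hj]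
      simp
  · have h0 : swap (l₁.length + 1) (l₁.length + 2) 0 = 0 :=
      swap_apply_of_ne_of_ne (by omega) (by omega)
    constructor
    · intro hd
      exact (swap _ _).injective (hd.trans h0.symm)
    · intro hd
      rw [hd, h0]

theorem eqvGen_swapStep (hs : Relation.EqvGen SwapStep f f') :
    (∃ lev, IsReading rot opp out f thr lev) ↔ ∃ lev, IsReading rot opp out f' thr lev := by
  induction hs with
  | rel f f' hs =>
    exact ⟨fun ⟨lev, h⟩ => (h.swapStep hs).imp fun _ h => h.1,
      fun ⟨lev, h⟩ => (h.swapStep hs.symm).imp fun _ h => h.1⟩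
  | refl _ => exact Iff.rfl
  | symm _ _ _ ih => exact ih.symm
  | trans _ _ _ _ _ ih₁ ih₂ => exact ih₁.trans ih₂

/-! ### The factorizations read off one map are equivalent -/

section TwoReadings

variable [Finite D] {lev' : D → ℕ}

/-- Inner vertices are whole levels, and the rotation at a vertex shows how its factor acts on the
symbols it moves. -/
theorem fac_apply_eq (h : IsReading rot opp out f thr lev) (h' : IsReading rot opp out f' thr lev')
    (hf : ∀ s ∈ f, s.IsCycle) {d : D} {i i' : ℕ} (hi : lev d = i + 1) (hlt : i < f.length)
    (hi' : lev' d = i' + 1) {x : Fin n} (hx : fac f i x ≠ x) :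
    fac f' i' x = fac f i x := by
  obtain ⟨e, h1, h2, h3⟩ := h.exists_out x i hx
  have hs : rot.SameCycle d e :=
    (h.sameCycle_rot_iff hf d e).2 ⟨hi.trans h3.symm, fun hc => by omega⟩
  have h4 : lev' e = i' + 1 := by rw [← apply_eq_of_sameCycle h'.lev_rot hs, hi']
  rw [← h2, ← (h.rot_out e i h1 h3).2.1, ← (h'.rot_out e i' h1 h4).2.1]

theorem fac_eq (h : IsReading rot opp out f thr lev) (h' : IsReading rot opp out f' thr lev')
    (hf : ∀ s ∈ f, s.IsCycle) (hf' : ∀ s ∈ f', s.IsCycle) {d : D} {i i' : ℕ}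
    (hi : lev d = i + 1) (hlt : i < f.length) (hi' : lev' d = i' + 1) (hlt' : i' < f'.length) :
    fac f i = fac f' i' := by
  ext x : 1
  by_cases hx : fac f i x = x
  · by_cases hx' : fac f' i' x = x
    · rw [hx, hx']
    · exact h'.fac_apply_eq h hf' hi' hlt' hi hx'
  · exact (h.fac_apply_eq h' hf hi hlt hi' hx).symm

open Classical in
omit [Finite D] in
theorem filter_drop_last (h : IsReading rot opp out f thr lev) {d : D} (hd : out d)
    (hl : lev (opp d) = f.length + 1) :
    (f.drop (lev d)).filter (fun s => s (thr d) ≠ thr d) = [] := by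
  rw [filter_drop_of_fixed f (h.lev_le_of_out hd)
    fun k h1 h2 => h.gap d k hd (by omega) (by omega)]
  simp

open Classical in
omit [Finite D] in
theorem filter_drop_step (h : IsReading rot opp out f thr lev) {d : D} (hd : out d) {i : ℕ}
    (hi : i < f.length) (hl : lev (opp d) = i + 1) :
    (f.drop (lev d)).filter (fun s => s (thr d) ≠ thr d) =
      fac f i :: (f.drop (i + 1)).filter (fun s => s (thr d) ≠ thr d) := by
  have hlt := h.lev_lt d hd
  have hm := h.moved hl hi
  rw [h.thr_opp, fac_of_lt f hi] at hm
  rw [filter_drop_of_fixed f (show lev d ≤ i by omega)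
    fun k h1 h2 => h.gap d k hd (by omega) (by omega), List.drop_eq_getElem_cons hi,
    List.filter_cons_of_pos (by simpa using hm), fac_of_lt f hi]

open Classical in
/-- From any edge onwards, the two factorizations have the same sequence of factors on its thread. -/
theorem filter_drop_eq (h : IsReading rot opp out f thr lev)
    (h' : IsReading rot opp out f' thr lev')
    (hf : ∀ s ∈ f, s.IsCycle) (hf' : ∀ s ∈ f', s.IsCycle) (d : D) (hd : out d) :
    (f.drop (lev d)).filter (fun s => s (thr d) ≠ thr d) =
      (f'.drop (lev' d)).filter (fun s => s (thr d) ≠ thr d) := by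
  induction hk : f.length + 1 - lev d using Nat.strong_induction_on generalizing d with
  | _ k ih =>
    have hin : ¬ out (opp d) := by simpa [h.out_opp] using hd
    by_cases hl : lev (opp d) = f.length + 1
    · rw [h.filter_drop_last hd hl, h'.filter_drop_last hd
        (h'.lev_eq_length_add_one_iff.2 (h.lev_eq_length_add_one_iff.1 hl))]
    · have hl' : lev' (opp d) ≠ f'.length + 1 := fun hc =>
        hl (h.lev_eq_length_add_one_iff.2 (h'.lev_eq_length_add_one_iff.1 hc))
      obtain ⟨i, hi, hx⟩ := (h.in_cases _ hin).resolve_left hl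
      obtain ⟨i', hi', hx'⟩ := (h'.in_cases _ hin).resolve_left hl'
      have hlt := lt_of_fac_ne f hx
      have hlt' := lt_of_fac_ne f' hx'
      rw [h.filter_drop_step hd hlt hi, h'.filter_drop_step hd hlt' hi',
        h.fac_eq h' hf hf' hi hlt hi' hlt']
      obtain ⟨h1, h2, h3⟩ := h.rot_in _ hin hl
      obtain ⟨-, -, h4⟩ := h'.rot_in _ hin hl'
      have hlev := h.lev_lt d hd
      have := ih (f.length + 1 - lev (rot (opp d))) (by omega) (rot (opp d)) h1 rfl
      rw [h2, h.thr_opp, h3, h4, hi, hi'] at this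
      rw [this]

/-- Two factorizations with readings of the same map, with the same threads, are equivalent. -/
theorem eqvGen_of_isReading (h : IsReading rot opp out f thr lev)
    (h' : IsReading rot opp out f' thr lev')
    (hf : ∀ s ∈ f, s.IsCycle) (hf' : ∀ s ∈ f', s.IsCycle) :
    Relation.EqvGen SwapStep f f' := by
  refine eqvGen_swapStep_of_filter_eq f f' (fun s hs => (hf s hs).ne_one)
    (fun s hs => (hf' s hs).ne_one) fun x => ?_
  obtain ⟨d, h1, h2, h3⟩ := h.exists_source x
  have := h.filter_drop_eq h' hf hf' d h1
  rw [h3, h'.lev_eq_zero_iff.2 (h.lev_eq_zero_iff.1 h3), h2] at this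
  exact this

end TwoReadings

/-! ### The threads are determined by the sources at the base points -/

section Threads

variable {thr' : D → Fin n} {lev' : D → ℕ}

/-- Walking back along a thread is independent of the reading, so that it ends at a source whose
symbol both readings assign to the thread. -/
theorem exists_common_source_out (h : IsReading rot opp out f thr lev)
    (h' : IsReading rot opp out f' thr' lev') (d : D) (hd : out d) :
    ∃ s, lev s = 0 ∧ thr s = thr d ∧ thr' s = thr' d := by
  induction hk : lev d using Nat.strong_induction_on generalizing d with
  | _ k ih =>
    subst hk
    by_cases h0 : lev d = 0
    · exact ⟨d, h0, rfl, rfl⟩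
    obtain ⟨e, he, he1, he2, he3⟩ := h.exists_rot_eq_out hd h0
    have ho := (h.out_opp e).2 he1
    have hlt := h.lev_lt _ ho
    rw [h.opp_opp] at hlt
    obtain ⟨s, h1, h2, h3⟩ := ih (lev (opp e)) (by omega) (opp e) ho rfl
    have hl' : lev' e ≠ f'.length + 1 := by
      intro hc
      have := (h'.lev_eq_length_add_one_iff.1 hc).2
      rw [he] at this
      exact he1 (this ▸ hd)
    refine ⟨s, h1, by rw [h2, h.thr_opp, he2], ?_⟩
    rw [h3, h'.thr_opp, ← he, (h'.rot_in e he1 hl').2.1]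

/-- Walking on along the boundary is independent of the reading, so that it ends at a source whose
symbol agrees with `faceSymbol` in both readings. -/
theorem exists_common_source_in (h : IsReading rot opp out f thr lev)
    (h' : IsReading rot opp out f' thr' lev') (d : D) (hd : ¬ out d) :
    ∃ s, lev s = 0 ∧ thr s = faceSymbol out f thr lev d ∧
      thr' s = faceSymbol out f' thr' lev' d := by
  induction hk : lev d using Nat.strong_induction_on generalizing d with
  | _ k ih =>
    subst hk
    have ho := (h.out_opp d).2 hd
    have hlt := h.lev_lt _ ho
    rw [h.opp_opp] at hlt
    rw [← h.faceSymbol_walk_in hd, ← h'.faceSymbol_walk_in hd]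
    rcases h.out_cases _ ho with h0 | ⟨i, hi, -⟩
    · rw [h.rot_source _ ho h0]
      exact ⟨opp d, h0, by simp [faceSymbol, ho], by simp [faceSymbol, ho]⟩
    · obtain ⟨h1, h2, h3⟩ := h.rot_out _ i ho hi
      exact ih _ (by omega) _ h1 rfl

/-- If two readings have the same product and agree at the sources of a set of symbols which meets
every cycle of the product, then they have the same threads. -/
theorem thr_eq (h : IsReading rot opp out f thr lev) (h' : IsReading rot opp out f' thr' lev')
    (hp : f.prod = f'.prod) (B : Set (Fin n))
    (hB : ∀ x, ∃ b ∈ B, f.prod.SameCycle b x)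
    (hb : ∀ s, lev s = 0 → thr s ∈ B → thr' s = thr s) : thr = thr' := by
  have huniq : ∀ s s', lev s = 0 → lev s' = 0 → thr s = thr s' → s = s' := by
    intro s s' hs hs' ht
    refine h.inj _ _ ht (hs.trans hs'.symm) ?_
    simp [(h.lev_eq_zero_iff.1 hs).1, (h.lev_eq_zero_iff.1 hs').1]
  -- the symbols whose source carries the same symbol in both readings are closed under the product
  have hnext : ∀ x, (∀ s, lev s = 0 → thr s = x → thr' s = x) →
      ∀ s, lev s = 0 → thr s = f.prod x → thr' s = f.prod x := by
    intro x hx s hs hsx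
    obtain ⟨t, h1, h2, h3⟩ := h.exists_sink x
    have ho := (h.out_opp t).2 h1
    obtain ⟨s₁, h4, h5, h6⟩ := h.exists_common_source_out h' _ ho
    rw [h.thr_opp, h2] at h5
    rw [h'.thr_opp, hx s₁ h4 h5] at h6
    obtain ⟨s₂, h7, h8, h9⟩ := h.exists_common_source_in h' t h1
    rw [faceSymbol_sink h1 h3, h2] at h8
    rw [faceSymbol_sink h1 (h'.lev_eq_length_add_one_iff.2 (h.lev_eq_length_add_one_iff.1 h3)),
      ← h6, ← hp] at h9
    rw [huniq s s₂ hs h7 (hsx.trans h8.symm), h9]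
  have hall : ∀ s, lev s = 0 → thr' s = thr s := by
    intro s hs
    obtain ⟨b, hbB, hbs⟩ := hB (thr s)
    obtain ⟨k, hk⟩ := hbs.exists_nat_pow_eq
    have key : ∀ k : ℕ, ∀ s, lev s = 0 → thr s = (f.prod ^ k) b → thr' s = (f.prod ^ k) b := by
      intro k
      induction k with
      | zero =>
        intro s hs hsb
        rw [pow_zero, Perm.one_apply] at hsb ⊢
        rw [hb s hs (hsb ▸ hbB), hsb]
      | succ k ih =>
        rw [pow_succ', Perm.mul_apply]
        exact hnext _ ih
    rw [key k s hs hk.symm, hk]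
  have hout : ∀ d, out d → thr d = thr' d := by
    intro d hd
    obtain ⟨s, h1, h2, h3⟩ := h.exists_common_source_out h' d hd
    rw [← h2, ← h3, hall s h1]
  funext d
  by_cases hd : out d
  · exact hout d hd
  · rw [← h.thr_opp, ← h'.thr_opp, hout _ ((h.out_opp d).2 hd)]

end Threads

end Raw

end IsReading

/-! ### Readings of decorated maps -/

/-- A reading of a decorated map in which the distinguished source of the face number `i` lies on
the thread `b i`. -/
structure IsRootedReading {m n : ℕ} (b : Fin m → Fin n) (M : DecoratedMap m)
    (f : List (Perm (Fin n))) (thr : M.Dart → Fin n) (lev : M.Dart → ℕ) : Prop where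
  isReading : IsReading M.rot M.opp M.IsOut f thr lev
  root_eq : ∀ i d, lev d = 0 → thr d = b i → M.vertexOf d = M.root i

namespace IsRootedReading

variable {m n : ℕ} {b : Fin m → Fin n} {M N : DecoratedMap m} {f f' : List (Perm (Fin n))}
  {thr thr' : M.Dart → Fin n} {lev lev' : M.Dart → ℕ}

/-- Sources being leaves, a distinguished source carries a single dart. -/
theorem vertexOf_eq_root_iff (h : IsRootedReading b M f thr lev) (d : M.Dart) (i : Fin m) :
    M.vertexOf d = M.root i ↔ lev d = 0 ∧ thr d = b i := by
  refine ⟨fun hd => ?_, fun hd => h.root_eq i d hd.1 hd.2⟩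
  obtain ⟨s, h1, h2, h3⟩ := h.isReading.exists_source (b i)
  rw [← h.root_eq i s h3 h2, h.isReading.vertexOf_eq_iff_of_outer (.inl h3)] at hd
  subst hd
  exact ⟨h3, h2⟩

theorem eqvGen (h : IsRootedReading b M f thr lev) (h' : IsRootedReading b M f' thr' lev')
    (hf : ∀ s ∈ f, s.IsCycle) (hf' : ∀ s ∈ f', s.IsCycle) (hp : f.prod = f'.prod)
    (hb : ∀ x, ∃ i, f.prod.SameCycle (b i) x) : Relation.EqvGen SwapStep f f' := by
  obtain rfl : thr = thr' := by
    refine h.isReading.thr_eq h'.isReading hp (Set.range b) (fun x => ?_) fun s hs => ?_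
    · obtain ⟨i, hi⟩ := hb x
      exact ⟨b i, ⟨i, rfl⟩, hi⟩
    · rintro ⟨i, hi⟩
      rw [← hi]
      exact ((h'.vertexOf_eq_root_iff s i).1 (h.root_eq i s hs hi.symm)).2
  exact h.isReading.eqvGen_of_isReading h'.isReading hf hf'

theorem of_eqvGen (h : IsRootedReading b M f thr lev) (hs : Relation.EqvGen SwapStep f f') :
    ∃ lev', IsRootedReading b M f' thr lev' := by
  obtain ⟨lev', h'⟩ := (IsReading.eqvGen_swapStep hs).1 ⟨lev, h.isReading⟩
  exact ⟨lev', h', fun i d hd =>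
    h.root_eq i d (h.isReading.lev_eq_zero_iff.2 (h'.lev_eq_zero_iff.1 hd))⟩

/-- The face labels are determined by the distinguished sources. -/
theorem label_eq (h : IsRootedReading b M f thr lev) (c : Fin n → Fin m)
    (hc : ∀ x y, c x = c y ↔ f.prod.SameCycle x y) (hb : ∀ i, c (b i) = i) (d : M.Dart) :
    M.label (M.faceOf d) = c (faceSymbol M.IsOut f thr lev d) := by
  generalize hi : c (faceSymbol M.IsOut f thr lev d) = i
  obtain ⟨e, h1, h2⟩ := M.root_incident i
  obtain ⟨h3, h4⟩ := (h.vertexOf_eq_root_iff e i).1 h1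
  rw [← Equiv.eq_symm_apply, ← h2, h.isReading.faceOf_eq_iff, ← hc, hi, faceSymbol,
    if_pos (h.isReading.isOut_of_lev_eq_zero h3), h4, hb]

/-- Readings pull back along isomorphisms. -/
theorem comp_iso {thr : N.Dart → Fin n} {lev : N.Dart → ℕ} (h : IsRootedReading b N f thr lev)
    (e : DecoratedMap.Iso M N) :
    IsRootedReading b M f (fun d => thr (e.toEquiv d)) (fun d => lev (e.toEquiv d)) where
  isReading :=
    { opp_opp := M.opp_opp
      out_opp := M.isOut_opp
      inj := fun d d' h1 h2 h3 => e.toEquiv.injective (h.isReading.inj _ _ h1 h2 (by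
        rw [e.map_isOut, e.map_isOut, h3]))
      exists_source := fun x => by
        obtain ⟨d, h1, h2⟩ := h.isReading.exists_source x
        exact ⟨e.toEquiv.symm d, by rw [← e.map_isOut]; simpa using h1, by simpa using h2⟩
      exists_sink := fun x => by
        obtain ⟨d, h1, h2⟩ := h.isReading.exists_sink x
        exact ⟨e.toEquiv.symm d, by rw [← e.map_isOut]; simpa using h1, by simpa using h2⟩
      exists_out := fun x i hx => by
        obtain ⟨d, h1, h2⟩ := h.isReading.exists_out x i hx
        exact ⟨e.toEquiv.symm d, by rw [← e.map_isOut]; simpa using h1, by simpa using h2⟩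
      out_cases := fun d hd => h.isReading.out_cases _ ((e.map_isOut d).2 hd)
      in_cases := fun d hd => h.isReading.in_cases _ (by rwa [e.map_isOut])
      rot_source := fun d hd hl => e.toEquiv.injective (by
        rw [e.map_rot, h.isReading.rot_source _ ((e.map_isOut d).2 hd) hl])
      rot_sink := fun d hd hl => e.toEquiv.injective (by
        rw [e.map_rot, h.isReading.rot_sink _ (by rwa [e.map_isOut]) hl])
      rot_out := fun d i hd hi => by
        rw [← e.map_isOut, e.map_rot]
        exact h.isReading.rot_out _ i ((e.map_isOut d).2 hd) hi
      rot_in := fun d hd hl => by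
        rw [← e.map_isOut, e.map_rot]
        exact h.isReading.rot_in _ (by rwa [e.map_isOut]) hl
      thr_opp := fun d => by rw [e.map_opp, h.isReading.thr_opp]
      lev_lt := fun d hd => by
        rw [e.map_opp]
        exact h.isReading.lev_lt _ ((e.map_isOut d).2 hd)
      gap := fun d i hd => by
        rw [e.map_opp]
        exact h.isReading.gap _ i ((e.map_isOut d).2 hd) }
  root_eq := fun i d hd ht => (e.map_root d i).1 (h.root_eq i _ hd ht)

end IsRootedReading

/-! ### Uniqueness of the map of a factorization -/

section Uniqueness

variable {n : ℕ} {f : List (Perm (Fin n))}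

/-- The thread, level and direction of the darts depend on the factorization only. -/
theorem IsReading.exists_match {D D' : Type} {rot opp : Perm D} {out : D → Prop}
    {thr : D → Fin n} {lev : D → ℕ} {rot' opp' : Perm D'} {out' : D' → Prop}
    {thr' : D' → Fin n} {lev' : D' → ℕ} (h : IsReading rot opp out f thr lev)
    (h' : IsReading rot' opp' out' f thr' lev') (d : D) :
    ∃ d', (out' d' ↔ out d) ∧ thr' d' = thr d ∧ lev' d' = lev d := by
  by_cases hd : out d
  · simp only [hd, iff_true]
    rcases h.out_cases d hd with h0 | ⟨i, hi, hx⟩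
    · rw [h0]
      exact h'.exists_source _
    · rw [hi]
      exact h'.exists_out _ _ hx
  · simp only [hd, iff_false]
    rcases h.in_cases d hd with h0 | ⟨i, hi, hx⟩
    · rw [h0]
      exact h'.exists_sink _
    · rw [hi]
      exact h'.exists_in _ _ hx

/-- The level at the far end of an edge depends on the factorization only: an earlier end would be a
crossing in the gap of the other edge. -/
theorem IsReading.lev_opp_le {D D' : Type} {rot opp : Perm D} {out : D → Prop}
    {thr : D → Fin n} {lev : D → ℕ} {rot' opp' : Perm D'} {out' : D' → Prop}
    {thr' : D' → Fin n} {lev' : D' → ℕ} (h : IsReading rot opp out f thr lev)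
    (h' : IsReading rot' opp' out' f thr' lev') {d : D} {d' : D'} (hd : out d) (hd' : out' d')
    (ht : thr' d' = thr d) (hl : lev' d' = lev d) : lev (opp d) ≤ lev' (opp' d') := by
  by_contra! hc
  have hin : ¬ out' (opp' d') := by simpa [h'.out_opp] using hd'
  have hlt := h'.lev_lt d' hd'
  rcases h'.in_cases _ hin with h0 | ⟨i, hi, hx⟩
  · have := h.lev_le (opp d)
    omega
  · rw [h'.thr_opp, ht] at hx
    exact hx (h.gap d i hd (by omega) (by omega))

/-- Two decorated maps with a reading of the same factorization are isomorphic. -/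
theorem IsRootedReading.nonempty_iso {m : ℕ} {b : Fin m → Fin n} {M N : DecoratedMap m}
    {thr : M.Dart → Fin n} {lev : M.Dart → ℕ} {thr' : N.Dart → Fin n} {lev' : N.Dart → ℕ}
    (h : IsRootedReading b M f thr lev) (h' : IsRootedReading b N f thr' lev')
    (c : Fin n → Fin m) (hc : ∀ x y, c x = c y ↔ f.prod.SameCycle x y)
    (hb : ∀ i, c (b i) = i) : Nonempty (DecoratedMap.Iso M N) := by
  have hr := h.isReading
  have hr' := h'.isReading
  choose e he using hr.exists_match hr'
  have hbij : Function.Bijective e := by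
    constructor
    · intro d d' hdd
      refine hr.inj d d' ?_ ?_ ?_
      · rw [← (he d).2.1, hdd, (he d').2.1]
      · rw [← (he d).2.2, hdd, (he d').2.2]
      · rw [← (he d).1, hdd, (he d').1]
    · intro d'
      obtain ⟨d, h1, h2, h3⟩ := hr'.exists_match hr d'
      refine ⟨d, hr'.inj _ _ ?_ ?_ ?_⟩
      · rw [(he d).2.1, h2]
      · rw [(he d).2.2, h3]
      · rw [(he d).1, h1]
  have hoppOut : ∀ d, M.IsOut d → e (M.opp d) = N.opp (e d) := by
    intro d hd
    have hd' : N.IsOut (e d) := (he d).1.2 hd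
    refine hr'.inj _ _ ?_ ?_ ?_
    · rw [(he _).2.1, hr.thr_opp, hr'.thr_opp, (he d).2.1]
    · rw [(he _).2.2]
      exact le_antisymm (hr.lev_opp_le hr' hd hd' (he d).2.1 (he d).2.2)
        (hr'.lev_opp_le hr hd' hd (he d).2.1.symm (he d).2.2.symm)
    · rw [(he _).1, M.isOut_opp, N.isOut_opp, (he d).1]
  refine ⟨⟨Equiv.ofBijective e hbij, fun d => ?_, fun d => ?_, fun d => (he d).1, fun d => ?_,
    fun d i => ?_⟩⟩
  · change e (M.rot d) = N.rot (e d)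
    by_cases hd : M.IsOut d
    · have hd' : N.IsOut (e d) := (he d).1.2 hd
      rcases hr.out_cases d hd with h0 | ⟨i, hi, -⟩
      · rw [hr.rot_source d hd h0, hr'.rot_source _ hd' ((he d).2.2.trans h0)]
      · obtain ⟨h1, h2, h3⟩ := hr.rot_out d i hd hi
        obtain ⟨h4, h5, h6⟩ := hr'.rot_out _ i hd' ((he d).2.2.trans hi)
        refine hr'.inj _ _ ?_ ?_ ?_
        · rw [(he _).2.1, h2, h5, (he d).2.1]
        · rw [(he _).2.2, h3, h6]
        · rw [(he _).1]
          simp [h1, h4]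
    · have hd' : ¬ N.IsOut (e d) := by rwa [(he d).1]
      by_cases hl : lev d = f.length + 1
      · rw [hr.rot_sink d hd hl, hr'.rot_sink _ hd' ((he d).2.2.trans hl)]
      · obtain ⟨h1, h2, h3⟩ := hr.rot_in d hd hl
        obtain ⟨h4, h5, h6⟩ := hr'.rot_in _ hd' (by rwa [(he d).2.2])
        refine hr'.inj _ _ ?_ ?_ ?_
        · rw [(he _).2.1, h2, h5, (he d).2.1]
        · rw [(he _).2.2, h3, h6, (he d).2.2]
        · rw [(he _).1]
          simp [h1, h4]
  · change e (M.opp d) = N.opp (e d)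
    by_cases hd : M.IsOut d
    · exact hoppOut d hd
    · have := hoppOut (M.opp d) ((M.isOut_opp d).2 hd)
      rw [M.opp_opp] at this
      rw [this, N.opp_opp]
  · change N.label (N.faceOf (e d)) = _
    rw [h'.label_eq c hc hb, h.label_eq c hc hb]
    congr 1
    by_cases hd : M.IsOut d <;> simp [faceSymbol, (he d).1, (he d).2.1, (he d).2.2, hd]
  · change N.vertexOf (e d) = _ ↔ _
    rw [h.vertexOf_eq_root_iff, h'.vertexOf_eq_root_iff, (he d).2.1, (he d).2.2]

end Uniqueness

/-! ### The map of a factorization -/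

section MapOfFactorization

variable {n : ℕ} (f : List (Perm (Fin n)))

/-- The darts of the map of a factorization: triples of a thread, a level, and a direction, `true`
meaning that the edge leaves the vertex. -/
def IsFactorizationDart (t : Fin n × ℕ × Bool) : Prop :=
  (t.2.1 = 0 ∧ t.2.2 = true) ∨ (t.2.1 = f.length + 1 ∧ t.2.2 = false) ∨
    ∃ i, t.2.1 = i + 1 ∧ fac f i t.1 ≠ t.1

/-- On the thread `x`, the level `l'` comes later than the level `l`, and no level strictly between
them meets the thread. -/
def IsNextLevel (x : Fin n) (l l' : ℕ) : Prop :=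
  l < l' ∧ ∀ i, l < i + 1 → i + 1 < l' → fac f i x = x

variable {f}

theorem exists_next_level {x : Fin n} {l : ℕ} (hl : l ≤ f.length) :
    ∃ l', IsNextLevel f x l l' ∧ IsFactorizationDart f (x, l', false) := by
  classical
  have hex : ∃ l', l < l' ∧ IsFactorizationDart f (x, l', false) :=
    ⟨f.length + 1, by omega, .inr (.inl ⟨rfl, rfl⟩)⟩
  obtain ⟨h1, h2⟩ := Nat.find_spec hex
  refine ⟨Nat.find hex, ⟨h1, fun i hi hi' => ?_⟩, h2⟩
  by_contra hx
  exact Nat.find_min hex hi' ⟨hi, .inr (.inr ⟨i, rfl, hx⟩)⟩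

theorem exists_prev_level {x : Fin n} {l : ℕ} (hl : 0 < l) :
    ∃ l', IsNextLevel f x l' l ∧ IsFactorizationDart f (x, l', true) := by
  classical
  let P : ℕ → Prop := fun l' => l' < l ∧ IsFactorizationDart f (x, l', true)
  have h0 : P 0 := ⟨hl, .inl ⟨rfl, rfl⟩⟩
  obtain ⟨h1, h2⟩ := Nat.findGreatest_spec (P := P) (Nat.zero_le l) h0
  refine ⟨Nat.findGreatest P l, ⟨h1, fun i hi hi' => ?_⟩, h2⟩
  by_contra hx
  exact Nat.findGreatest_is_greatest hi hi'.le ⟨hi', .inr (.inr ⟨i, rfl, hx⟩)⟩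

theorem IsNextLevel.right_unique {x : Fin n} {l l₁ l₂ : ℕ} (h₁ : IsNextLevel f x l l₁)
    (h₂ : IsNextLevel f x l l₂) (hd₁ : IsFactorizationDart f (x, l₁, false))
    (hd₂ : IsFactorizationDart f (x, l₂, false)) : l₁ = l₂ := by
  have key : ∀ {l₁ l₂}, IsNextLevel f x l l₁ → IsNextLevel f x l l₂ →
      IsFactorizationDart f (x, l₁, false) → IsFactorizationDart f (x, l₂, false) →
      l₂ ≤ l₁ := by
    intro l₁ l₂ h₁ h₂ hd₁ hd₂
    by_contra! hlt
    rcases hd₁ with ⟨-, h⟩ | ⟨h, -⟩ | ⟨i, hi, hx⟩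
    · simp at h
    · simp only at h
      rcases hd₂ with ⟨-, h'⟩ | ⟨h', -⟩ | ⟨i, hi, hx⟩
      · simp at h'
      · simp only at h'
        omega
      · have := lt_of_fac_ne f hx
        simp only at hi
        omega
    · simp only at hi
      exact hx (h₂.2 i (by have := h₁.1; omega) (by omega))
  exact le_antisymm (key h₂ h₁ hd₂ hd₁) (key h₁ h₂ hd₁ hd₂)

theorem IsNextLevel.left_unique {x : Fin n} {l l₁ l₂ : ℕ} (h₁ : IsNextLevel f x l₁ l)
    (h₂ : IsNextLevel f x l₂ l) (hd₁ : IsFactorizationDart f (x, l₁, true))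
    (hd₂ : IsFactorizationDart f (x, l₂, true)) : l₁ = l₂ := by
  have key : ∀ {l₁ l₂}, IsNextLevel f x l₁ l → IsNextLevel f x l₂ l →
      IsFactorizationDart f (x, l₂, true) → l₂ ≤ l₁ := by
    intro l₁ l₂ h₁ h₂ hd₂
    by_contra! hlt
    rcases hd₂ with ⟨h, -⟩ | ⟨-, h⟩ | ⟨i, hi, hx⟩
    · simp only at h
      omega
    · simp at h
    · simp only at hi
      exact hx (h₁.2 i (by omega) (by have := h₂.1; omega))
  exact le_antisymm (key h₂ h₁ hd₁) (key h₁ h₂ hd₂)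

variable (f)

instance finite_factorizationDart : Finite {t // IsFactorizationDart f t} := by
  have hle : ∀ t, IsFactorizationDart f t → t.2.1 < f.length + 2 := by
    rintro t (⟨h, -⟩ | ⟨h, -⟩ | ⟨i, h, hx⟩)
    · omega
    · omega
    · have := lt_of_fac_ne f hx
      omega
  refine Finite.of_injective
    (fun t : {t // IsFactorizationDart f t} =>
      ((t.1.1, ⟨t.1.2.1, hle _ t.2⟩, t.1.2.2) : Fin n × Fin (f.length + 2) × Bool)) ?_
  rintro ⟨⟨x, l, b⟩, ht⟩ ⟨⟨x', l', b'⟩, ht'⟩ h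
  simp only [Prod.mk.injEq, Fin.mk.injEq] at h
  exact Subtype.ext (by simp [h.1, h.2.1, h.2.2])

/-- Two darts of the map of a factorization are the halves of one edge. -/
def IsOppositeDart (t t' : Fin n × ℕ × Bool) : Prop :=
  t'.1 = t.1 ∧ t'.2.2 = !t.2.2 ∧ (t.2.2 = true → IsNextLevel f t.1 t.2.1 t'.2.1) ∧
    (t.2.2 = false → IsNextLevel f t.1 t'.2.1 t.2.1)

variable {f}

theorem IsOppositeDart.symm {t t' : Fin n × ℕ × Bool} (h : IsOppositeDart f t t') :
    IsOppositeDart f t' t := by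
  obtain ⟨x, l, b⟩ := t
  obtain ⟨x', l', b'⟩ := t'
  obtain ⟨h1, h2, h3, h4⟩ := h
  simp only at h1 h2 h3 h4
  subst h1 h2
  exact ⟨rfl, by simp, fun hb => h4 (by simpa using hb), fun hb => h3 (by simpa using hb)⟩

theorem exists_oppositeDart (t : Fin n × ℕ × Bool) (ht : IsFactorizationDart f t) :
    ∃ t', IsFactorizationDart f t' ∧ IsOppositeDart f t t' := by
  obtain ⟨x, l, b⟩ := t
  cases b
  · obtain ⟨l', h1, h2⟩ := exists_prev_level (f := f) (x := x) (l := l) (by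
      rcases ht with ⟨-, h⟩ | ⟨h, -⟩ | ⟨i, h, hx⟩
      · simp at h
      · simp only at h; omega
      · simp only at h; omega)
    exact ⟨(x, l', true), h2, rfl, rfl, by simp, fun _ => h1⟩
  · obtain ⟨l', h1, h2⟩ := exists_next_level (f := f) (x := x) (l := l) (by
      rcases ht with ⟨h, -⟩ | ⟨-, h⟩ | ⟨i, h, hx⟩
      · simp only at h; omega
      · simp at h
      · have := lt_of_fac_ne f hx
        simp only at h
        omega)
    exact ⟨(x, l', false), h2, rfl, rfl, fun _ => h1, by simp⟩

theorem oppositeDart_unique {t t₁ t₂ : Fin n × ℕ × Bool} (h₁ : IsOppositeDart f t t₁)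
    (h₂ : IsOppositeDart f t t₂) (ht₁ : IsFactorizationDart f t₁)
    (ht₂ : IsFactorizationDart f t₂) : t₁ = t₂ := by
  obtain ⟨x, l, b⟩ := t
  obtain ⟨x₁, l₁, b₁⟩ := t₁
  obtain ⟨x₂, l₂, b₂⟩ := t₂
  obtain ⟨h1, h2, h3, h4⟩ := h₁
  obtain ⟨h1', h2', h3', h4'⟩ := h₂
  simp only at h1 h2 h3 h4 h1' h2' h3' h4'
  subst h1 h2 h1' h2'
  cases b
  · rw [(h4 rfl).left_unique (h4' rfl) ht₁ ht₂]
  · rw [(h3 rfl).right_unique (h3' rfl) ht₁ ht₂]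

variable (f)

theorem isFactorizationDart_inner (x : Fin n) (i : ℕ) (b : Bool) (hx : fac f i x ≠ x) :
    IsFactorizationDart f (x, i + 1, b) :=
  .inr (.inr ⟨i, rfl, hx⟩)

open Classical in
/-- The rotation of the map of a factorization. -/
noncomputable def factorizationRot (t : {t // IsFactorizationDart f t}) :
    {t // IsFactorizationDart f t} :=
  if h : fac f (t.1.2.1 - 1) t.1.1 ≠ t.1.1 ∧ t.1.2.1 ≠ 0 then
    if t.1.2.2 = true then
      ⟨(fac f (t.1.2.1 - 1) t.1.1, t.1.2.1 - 1 + 1, false),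
        isFactorizationDart_inner f _ _ _ fun hc => h.1 ((fac f _).injective hc)⟩
    else ⟨(t.1.1, t.1.2.1 - 1 + 1, true), isFactorizationDart_inner f _ _ _ h.1⟩
  else t

theorem factorizationRot_inner_out (x : Fin n) (i : ℕ) (hx : fac f i x ≠ x) :
    factorizationRot f ⟨(x, i + 1, true), isFactorizationDart_inner f x i true hx⟩ =
      ⟨(fac f i x, i + 1, false), isFactorizationDart_inner f _ i _
        fun hc => hx ((fac f _).injective hc)⟩ := by
  simp [factorizationRot, hx]

theorem factorizationRot_inner_in (x : Fin n) (i : ℕ) (hx : fac f i x ≠ x) :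
    factorizationRot f ⟨(x, i + 1, false), isFactorizationDart_inner f x i false hx⟩ =
      ⟨(x, i + 1, true), isFactorizationDart_inner f x i true hx⟩ := by
  simp [factorizationRot, hx]

theorem factorizationRot_outer (t : {t // IsFactorizationDart f t})
    (ht : t.1.2.1 = 0 ∨ t.1.2.1 = f.length + 1) : factorizationRot f t = t := by
  rw [factorizationRot, dif_neg]
  rintro ⟨h1, h2⟩
  have := lt_of_fac_ne f h1
  omega

/-- The darts are sources, sinks, and the two kinds of darts at inner vertices. -/
theorem factorizationDart_cases (t : {t // IsFactorizationDart f t}) :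
    (t.1.2.1 = 0 ∧ t.1.2.2 = true) ∨ (t.1.2.1 = f.length + 1 ∧ t.1.2.2 = false) ∨
      (∃ x i hx, t = ⟨(x, i + 1, true), isFactorizationDart_inner f x i true hx⟩) ∨
      ∃ x i hx, t = ⟨(x, i + 1, false), isFactorizationDart_inner f x i false hx⟩ := by
  obtain ⟨⟨x, l, b⟩, ht⟩ := t
  rcases ht with h | h | ⟨i, hi, hx⟩
  · exact .inl h
  · exact .inr (.inl h)
  · simp only at hi hx
    subst hi
    cases b
    · exact .inr (.inr (.inr ⟨x, i, hx, rfl⟩))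
    · exact .inr (.inr (.inl ⟨x, i, hx, rfl⟩))

theorem factorizationRot_bijective : Function.Bijective (factorizationRot f) := by
  refine Function.Surjective.bijective_of_finite fun t => ?_
  rcases factorizationDart_cases f t with h | h | ⟨x, i, hx, rfl⟩ | ⟨x, i, hx, rfl⟩
  · exact ⟨t, factorizationRot_outer f t (.inl h.1)⟩
  · exact ⟨t, factorizationRot_outer f t (.inr h.1)⟩
  · exact ⟨_, factorizationRot_inner_in f x i hx⟩
  · have hx' : fac f i ((fac f i)⁻¹ x) ≠ (fac f i)⁻¹ x := by
      intro hc
      apply hx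
      simpa using congrArg (fac f i) hc
    refine ⟨_, (factorizationRot_inner_out f _ i hx').trans ?_⟩
    simp

/-- Every list of permutations has a reading off some rotation system. -/
theorem exists_isReading : ∃ (D : Type) (_ : Finite D) (rot opp : Perm D) (out : D → Prop)
    (thr : D → Fin n) (lev : D → ℕ), IsReading rot opp out f thr lev := by
  choose o ho using fun t : {t // IsFactorizationDart f t} => exists_oppositeDart t.1 t.2
  let opp : {t // IsFactorizationDart f t} → {t // IsFactorizationDart f t} :=
    fun t => ⟨o t, (ho t).1⟩
  have hopp : ∀ t, IsOppositeDart f t.1 (opp t).1 := fun t => (ho t).2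
  have hinv : Function.Involutive opp := fun t =>
    Subtype.ext (oppositeDart_unique (hopp (opp t)) (hopp t).symm (opp (opp t)).2 t.2)
  refine ⟨{t // IsFactorizationDart f t}, inferInstance,
    Equiv.ofBijective _ (factorizationRot_bijective f), hinv.toPerm, fun t => t.1.2.2 = true,
    fun t => t.1.1, fun t => t.1.2.1, ?_⟩
  have hcases := factorizationDart_cases f
  exact
    { opp_opp := hinv
      out_opp := fun t => by
        have := (hopp t).2.1
        change (opp t).1.2.2 = true ↔ _
        rw [this]
        simp
      inj := fun t t' h1 h2 h3 => Subtype.ext (Prod.ext h1 (Prod.ext h2 (Bool.eq_iff_iff.2 h3)))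
      exists_source := fun x => ⟨⟨(x, 0, true), .inl ⟨rfl, rfl⟩⟩, rfl, rfl, rfl⟩
      exists_sink := fun x =>
        ⟨⟨(x, f.length + 1, false), .inr (.inl ⟨rfl, rfl⟩)⟩, by simp, rfl, rfl⟩
      exists_out := fun x i hx => ⟨⟨_, isFactorizationDart_inner f x i true hx⟩, rfl, rfl, rfl⟩
      out_cases := fun t ht => by
        rcases t.2 with h | h | h
        · exact .inl h.1
        · rw [h.2] at ht
          simp at ht
        · exact .inr h
      in_cases := fun t ht => by
        rcases t.2 with h | h | h
        · exact absurd h.2 ht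
        · exact .inl h.1
        · exact .inr h
      rot_source := fun t _ ht => factorizationRot_outer f t (.inl ht)
      rot_sink := fun t _ ht => factorizationRot_outer f t (.inr ht)
      rot_out := fun t i ht hi => by
        rcases hcases t with h | h | ⟨x, j, hx, rfl⟩ | ⟨x, j, hx, rfl⟩
        · omega
        · rw [h.2] at ht
          simp at ht
        · obtain rfl : j = i := by simpa using hi
          rw [Equiv.ofBijective_apply, factorizationRot_inner_out f x j hx]
          simp
        · simp at ht
      rot_in := fun t ht hl => by
        rcases hcases t with h | h | ⟨x, j, hx, rfl⟩ | ⟨x, j, hx, rfl⟩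
        · exact absurd h.2 ht
        · exact absurd h.1 hl
        · simp at ht
        · rw [Equiv.ofBijective_apply, factorizationRot_inner_in f x j hx]
          simp
      thr_opp := fun t => (hopp t).1
      lev_lt := fun t ht => ((hopp t).2.2.1 ht).1
      gap := fun t i ht => ((hopp t).2.2.1 ht).2 i }

end MapOfFactorization

/-- Every transitive factorization is read off some decorated map. -/
theorem exists_isRootedReading {m n : ℕ} (hn : 0 < n) (f : List (Perm (Fin n)))
    (hf : IsTransitive f) (c : Fin n → Fin m) (hc : ∀ x y, c x = c y ↔ f.prod.SameCycle x y)
    (b : Fin m → Fin n) (hb : ∀ i, c (b i) = i) :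
    ∃ (M : DecoratedMap m) (thr : M.Dart → Fin n) (lev : M.Dart → ℕ),
      IsRootedReading b M f thr lev := by
  obtain ⟨D, _, rot, opp, out, thr, lev, h⟩ := exists_isReading f
  choose s hs using h.exists_source
  let M : DirectedMap :=
    { Dart := D
      nonempty_dart := ⟨s ⟨0, hn⟩⟩
      rot := rot
      opp := opp
      opp_opp := h.opp_opp
      opp_ne := fun d hd => by
        have := h.out_opp d
        rw [hd] at this
        tauto
      connected := h.isPretransitive_iff.2 hf
      IsOut := out
      isOut_opp := h.out_opp }
  have hM : IsReading M.rot M.opp M.IsOut f thr lev := h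
  let F : M.Face → Fin m := Quotient.lift (fun d => c (faceSymbol out f thr lev d))
    fun d d' hd => (hc _ _).2 ((h.sameCycle_face_iff d d').1 hd)
  have hF : ∀ d, F (M.faceOf d) = c (faceSymbol out f thr lev d) := fun d => rfl
  have hFs : ∀ x, F (M.faceOf (s x)) = c x := fun x => by
    rw [hF, faceSymbol, if_pos (hs x).1, (hs x).2.1]
  have hbij : Function.Bijective F := by
    constructor
    · intro u v huv
      obtain ⟨d, rfl⟩ := DirectedMap.exists_faceOf_eq u
      obtain ⟨d', rfl⟩ := DirectedMap.exists_faceOf_eq v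
      rw [hF, hF, hc] at huv
      exact hM.faceOf_eq_iff.2 huv
    · intro i
      exact ⟨M.faceOf (s (b i)), by rw [hFs, hb]⟩
  refine ⟨{ M with
    label := Equiv.ofBijective F hbij
    root := fun i => M.vertexOf (s (b i))
    root_isSource := fun i => hM.isSource_iff.2 (hs _).2.2
    root_incident := fun i => ⟨s (b i), rfl, ?_⟩ }, thr, lev, hM, ?_⟩
  · rw [Equiv.eq_symm_apply, Equiv.ofBijective_apply]
    exact (hFs _).trans (hb i)
  · intro i d hd ht
    have : d = s (b i) := h.inj _ _ (ht.trans (hs _).2.1.symm) (hd.trans (hs _).2.2.symm) (by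
      simp [(hs (b i)).1, (h.lev_eq_zero_iff.1 hd).1])
    rw [this]

/-! ### Threads, levels and factors of an acyclic alternating map -/

namespace DirectedMap

open Relation

variable {M : DirectedMap}

instance finite_vertex : Finite M.Vertex :=
  inferInstanceAs (Finite (Quotient (Perm.SameCycle.setoid M.rot)))

theorem wellFounded_arc (hac : M.IsAcyclic) : WellFounded (TransGen M.Arc) := by
  have : Std.Irrefl (TransGen M.Arc) := ⟨hac⟩
  exact Finite.wellFounded_of_trans_of_irrefl _

theorem wellFounded_swap_arc (hac : M.IsAcyclic) :
    WellFounded (Function.swap (TransGen M.Arc)) := by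
  have : Std.Irrefl (Function.swap (TransGen M.Arc)) := ⟨hac⟩
  have : IsTrans _ (Function.swap (TransGen M.Arc)) := ⟨fun _ _ _ h h' => h'.trans h⟩
  exact Finite.wellFounded_of_trans_of_irrefl _

/-- Two consecutive edges of a thread, each represented by its outgoing dart. -/
def Step (M : DirectedMap) (d d' : M.Dart) : Prop := M.IsOut d ∧ M.IsOut d' ∧ d' = M.rot (M.opp d)

theorem not_isOut_opp {d : M.Dart} (hd : M.IsOut d) : ¬ M.IsOut (M.opp d) := by
  rwa [M.isOut_opp, not_not]

theorem Step.arc {d d' : M.Dart} (h : M.Step d d') : M.Arc (M.vertexOf d) (M.vertexOf d') :=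
  ⟨d, h.1, rfl, by rw [h.2.2, vertexOf_rot]⟩

theorem step_rightUnique : Relator.RightUnique M.Step := fun _ _ _ h h' =>
  h.2.2.trans h'.2.2.symm

theorem not_step_source {d s : M.Dart} (hs : M.rot s = s) : ¬ M.Step d s := by
  rintro ⟨h1, h2, h3⟩
  have h4 : s = M.opp d := M.rot.injective (hs.trans h3)
  exact not_isOut_opp h1 (h4 ▸ h2)

theorem step_leftUnique : Relator.LeftUnique M.Step := fun _ _ _ h h' =>
  M.opp.injective (M.rot.injective (h.2.2.symm.trans h'.2.2))

theorem reflTransGen_source_eq {d s : M.Dart} (hs : M.rot s = s)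
    (h : ReflTransGen M.Step d s) : d = s := by
  rcases h.cases_tail with h | ⟨c, -, h⟩
  · exact h.symm
  · exact absurd h (not_step_source hs)

theorem arc_of_reflTransGen {d d' : M.Dart} (h : ReflTransGen M.Step d d') (hne : d ≠ d') :
    TransGen M.Arc (M.vertexOf d) (M.vertexOf d') := by
  rcases reflTransGen_iff_eq_or_transGen.1 h with h | h
  · exact absurd h.symm hne
  · exact h.lift _ fun a b (hs : M.Step a b) => hs.arc

theorem rot_eq_self_of_vertexOf_eq {d d' : M.Dart} (h : M.vertexOf d = M.vertexOf d') :
    M.rot d = d ↔ M.rot d' = d' :=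
  (vertexOf_eq_iff.1 h).apply_eq_self_iff

/-- A vertex at which the rotation is an involution has degree at most `2`. -/
theorem rot_rot_ne (hd : M.IsAlternating)
    (hv : ∀ v, M.IsSource v ∨ M.IsSink v ∨ (Even (M.degree v) ∧ 4 ≤ M.degree v))
    {d : M.Dart} (h : M.rot d ≠ d) : M.rot (M.rot d) ≠ d := by
  intro h2
  have hdeg : 4 ≤ M.degree (M.vertexOf d) := by
    have halt := hd d h
    rcases hv (M.vertexOf d) with hs | hs | hs
    · exact absurd (hs d rfl) (halt.1 (hs _ (M.vertexOf_rot d)))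
    · exact absurd (halt.2 (hs d rfl)) (hs _ (M.vertexOf_rot d))
    · exact hs.2
  have hle : M.degree (M.vertexOf d) ≤ Nat.card Bool := by
    refine Nat.card_le_card_of_surjective
      (fun b : Bool => if b then ⟨d, rfl⟩ else ⟨M.rot d, M.vertexOf_rot d⟩) ?_
    rintro ⟨e, he⟩
    obtain ⟨k, hk⟩ := (vertexOf_eq_iff.1 he.symm).exists_nat_pow_eq
    have key : ∀ k : ℕ, (M.rot ^ k) d = d ∨ (M.rot ^ k) d = M.rot d := by
      intro k
      induction k with
      | zero => exact .inl rfl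
      | succ k ih =>
        rw [pow_succ', Perm.mul_apply]
        rcases ih with h | h
        · exact .inr (by rw [h])
        · exact .inl (by rw [h, h2])
    rcases key k with h | h
    · exact ⟨true, by simp [← hk, h]⟩
    · exact ⟨false, by simp [← hk, h]⟩
  simp only [Nat.card_eq_fintype_card, Fintype.card_bool] at hle
  omega

/-- The darts fall into threads, one for each source: the edges of a thread form a directed path
from a source, turning at each inner vertex to the next dart in counter-clockwise order. -/
theorem exists_threads (hac : M.IsAcyclic) (hal : M.IsAlternating) {X : Type*}
    (es : {d // M.IsOut d ∧ M.rot d = d} ≃ X) :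
    ∃ thr : M.Dart → X, (∀ d, thr (M.opp d) = thr d) ∧
      (∀ d, ¬ M.IsOut d → M.rot d ≠ d → thr (M.rot d) = thr d) ∧
      (∀ x, ∃ s, M.IsOut s ∧ M.rot s = s ∧ thr s = x) ∧
      (∀ d d', M.IsOut d → M.IsOut d' → thr d = thr d' →
        ReflTransGen M.Step d d' ∨ ReflTransGen M.Step d' d) := by
  classical
  have hex : ∀ d : {d // M.IsOut d}, ∃ s : {d // M.IsOut d ∧ M.rot d = d},
      ReflTransGen M.Step s.1 d.1 := by
    rintro ⟨d, hd⟩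
    generalize hv : M.vertexOf d = v
    induction v using (wellFounded_arc hac).induction generalizing d with
    | _ v ih =>
      subst hv
      by_cases hr : M.rot d = d
      · exact ⟨⟨d, hd, hr⟩, .refl⟩
      obtain ⟨e, rfl⟩ := M.rot.surjective d
      have he : M.rot e ≠ e := fun h => hr (by rw [h, h])
      have he' : ¬ M.IsOut e := (hal e he).1 hd
      have hst : M.Step (M.opp e) (M.rot e) := ⟨(M.isOut_opp e).2 he', hd, by rw [M.opp_opp]⟩
      obtain ⟨s, hs⟩ := ih _ (.single hst.arc) (M.opp e) hst.1 rfl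
      exact ⟨s, hs.tail hst⟩
  choose src hsrc using hex
  have huniq : ∀ (d : {d // M.IsOut d}) (s : {d // M.IsOut d ∧ M.rot d = d}),
      ReflTransGen M.Step s.1 d.1 → src d = s := by
    intro d s hs
    have hrev : Relator.RightUnique (Function.swap M.Step) := fun _ _ _ h h' =>
      step_leftUnique h h'
    have h1 := reflTransGen_swap.2 hs
    have h2 := reflTransGen_swap.2 (hsrc d)
    rcases ReflTransGen.total_of_right_unique hrev h1 h2 with h | h
    · exact Subtype.ext (reflTransGen_source_eq s.2.2 (reflTransGen_swap.1 h))
    · exact Subtype.ext (reflTransGen_source_eq (src d).2.2 (reflTransGen_swap.1 h)).symm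
  let tail : M.Dart → {d // M.IsOut d} := fun d =>
    if hd : M.IsOut d then ⟨d, hd⟩ else ⟨M.opp d, (M.isOut_opp d).2 hd⟩
  have htail : ∀ d (hd : M.IsOut d), tail d = ⟨d, hd⟩ := fun d hd => by simp [tail, hd]
  have htail' : ∀ d (hd : ¬ M.IsOut d), tail d = ⟨M.opp d, (M.isOut_opp d).2 hd⟩ :=
    fun d hd => by simp [tail, hd]
  refine ⟨fun d => es (src (tail d)), fun d => ?_, fun d hd hr => ?_, fun x => ?_,
    fun d d' hd hd' h => ?_⟩
  · by_cases hd : M.IsOut d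
    · simp only [htail d hd, htail' _ (not_isOut_opp hd), M.opp_opp]
    · simp only [htail' d hd, htail _ ((M.isOut_opp d).2 hd)]
  · have hro : M.IsOut (M.rot d) := (hal d hr).2 hd
    have hst : M.Step (M.opp d) (M.rot d) := ⟨(M.isOut_opp d).2 hd, hro, by rw [M.opp_opp]⟩
    simp only [htail' d hd, htail _ hro]
    rw [huniq ⟨M.rot d, hro⟩ _ ((hsrc ⟨M.opp d, hst.1⟩).tail hst)]
  · refine ⟨(es.symm x).1, (es.symm x).2.1, (es.symm x).2.2, ?_⟩
    simp only [htail _ (es.symm x).2.1]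
    rw [huniq ⟨_, (es.symm x).2.1⟩ (es.symm x) .refl, es.apply_symm_apply]
  · simp only [htail d hd, htail d' hd', es.apply_eq_iff_eq] at h
    have h1 := hsrc ⟨d, hd⟩
    have h2 := hsrc ⟨d', hd'⟩
    rw [← h] at h2
    exact ReflTransGen.total_of_right_unique step_rightUnique h1 h2

/-- The inner vertices can be numbered in such a way that numbers increase along edges. -/
theorem exists_levels (hac : M.IsAcyclic) :
    ∃ (r : ℕ) (lev : M.Dart → ℕ), (∀ d, lev d ≤ r + 1) ∧
      (∀ d, lev d = 0 ↔ M.IsOut d ∧ M.rot d = d) ∧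
      (∀ d, lev d = r + 1 ↔ ¬ M.IsOut d ∧ M.rot d = d) ∧
      (∀ d d', M.rot d ≠ d → (lev d = lev d' ↔ M.vertexOf d = M.vertexOf d')) ∧
      (∀ i, i < r → ∃ d, M.rot d ≠ d ∧ lev d = i + 1) ∧
      (∀ d, M.IsOut d → lev d < lev (M.opp d)) := by
  classical
  obtain ⟨r, e, he⟩ := exists_equiv_fin_of_acyclic
    (I := {v : M.Vertex // ∃ d, M.vertexOf d = v ∧ M.rot d ≠ d}) (fun u v => M.Arc u.1 v.1)
    (fun a ha => hac a.1 (ha.lift Subtype.val fun _ _ => id))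
  let lev : M.Dart → ℕ := fun d =>
    if hd : M.rot d ≠ d then (e ⟨M.vertexOf d, d, rfl, hd⟩ : ℕ) + 1 else
      if M.IsOut d then 0 else r + 1
  have hin : ∀ d (hd : M.rot d ≠ d), lev d = (e ⟨M.vertexOf d, d, rfl, hd⟩ : ℕ) + 1 :=
    fun d hd => by simp [lev, hd]
  have hsrc : ∀ d, M.IsOut d → M.rot d = d → lev d = 0 := fun d h1 h2 => by simp [lev, h1, h2]
  have hsnk : ∀ d, ¬ M.IsOut d → M.rot d = d → lev d = r + 1 :=
    fun d h1 h2 => by simp [lev, h1, h2]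
  have hcases : ∀ d, (M.IsOut d ∧ M.rot d = d) ∨ (¬ M.IsOut d ∧ M.rot d = d) ∨ M.rot d ≠ d := by
    intro d
    tauto
  have hlt : ∀ d (hd : M.rot d ≠ d), 0 < lev d ∧ lev d < r + 1 := by
    intro d hd
    rw [hin d hd]
    have := (e ⟨M.vertexOf d, d, rfl, hd⟩).2
    omega
  refine ⟨r, lev, fun d => ?_, fun d => ?_, fun d => ?_, fun d d' hd => ?_, fun i hi => ?_,
    fun d hd => ?_⟩
  · rcases hcases d with h | h | h
    · rw [hsrc d h.1 h.2]; omega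
    · rw [hsnk d h.1 h.2]
    · exact (hlt d h).2.le
  · refine ⟨fun h0 => ?_, fun h => hsrc d h.1 h.2⟩
    rcases hcases d with h | h | h
    · exact h
    · rw [hsnk d h.1 h.2] at h0; omega
    · have := hlt d h; omega
  · refine ⟨fun h0 => ?_, fun h => hsnk d h.1 h.2⟩
    rcases hcases d with h | h | h
    · rw [hsrc d h.1 h.2] at h0; omega
    · exact h
    · have := hlt d h; omega
  · have h1 := hlt d hd
    rcases hcases d' with h | h | h
    · rw [hsrc d' h.1 h.2]
      refine ⟨fun _ => by omega, fun hv => absurd ((rot_eq_self_of_vertexOf_eq hv).2 h.2) hd⟩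
    · rw [hsnk d' h.1 h.2]
      refine ⟨fun _ => by omega, fun hv => absurd ((rot_eq_self_of_vertexOf_eq hv).2 h.2) hd⟩
    · rw [hin d hd, hin d' h, Nat.add_right_cancel_iff, Fin.val_inj, e.apply_eq_iff_eq,
        Subtype.mk.injEq]
  · obtain ⟨⟨v, d, rfl, hd⟩, hv⟩ := e.surjective ⟨i, hi⟩
    exact ⟨d, hd, by rw [hin d hd, hv]⟩
  · have ho := not_isOut_opp hd
    by_cases hr : M.rot d = d
    · rw [hsrc d hd hr]
      by_cases hr' : M.rot (M.opp d) = M.opp d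
      · rw [hsnk _ ho hr']; omega
      · exact (hlt _ hr').1
    · by_cases hr' : M.rot (M.opp d) = M.opp d
      · rw [hsnk _ ho hr']
        exact (hlt d hr).2
      · rw [hin d hr, hin _ hr']
        have := he ⟨M.vertexOf d, d, rfl, hr⟩ ⟨M.vertexOf (M.opp d), _, rfl, hr'⟩
          ⟨d, hd, rfl, rfl⟩
        simpa using this

/-- At an inner vertex the rotation by two darts permutes the threads of the outgoing darts in one
cycle; this is the factor attached to the vertex. -/
theorem exists_factor {X : Type*} (hal : M.IsAlternating)
    (hv : ∀ v, M.IsSource v ∨ M.IsSink v ∨ (Even (M.degree v) ∧ 4 ≤ M.degree v))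
    {thr : M.Dart → X}
    (hin : ∀ d, ¬ M.IsOut d → M.rot d ≠ d → thr (M.rot d) = thr d)
    (hinj : ∀ d d', M.IsOut d → M.IsOut d' → M.vertexOf d = M.vertexOf d' → thr d = thr d' →
      d = d')
    {d₀ : M.Dart} (hd₀ : M.rot d₀ ≠ d₀) :
    ∃ s : Perm X, s.IsCycle ∧
      (∀ d, M.IsOut d → M.vertexOf d = M.vertexOf d₀ → s (thr d) = thr (M.rot d)) ∧
      ∀ x, s x ≠ x ↔ ∃ d, M.IsOut d ∧ M.vertexOf d = M.vertexOf d₀ ∧ thr d = x := by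
  have hne : ∀ d, M.vertexOf d = M.vertexOf d₀ → M.rot d ≠ d := fun d hd h =>
    hd₀ ((rot_eq_self_of_vertexOf_eq hd).1 h)
  have hrr : ∀ d, (M.IsOut ((M.rot ^ 2) d) ∧ M.vertexOf ((M.rot ^ 2) d) = M.vertexOf d₀) ↔
      (M.IsOut d ∧ M.vertexOf d = M.vertexOf d₀) := by
    intro d
    rw [pow_two, Perm.mul_apply, vertexOf_rot, vertexOf_rot]
    refine and_congr_left fun hd => ?_
    rw [hal _ (hne (M.rot d) ((vertexOf_rot d).trans hd)), hal d (hne d hd), not_not]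
  -- rotation by two darts preserves the outgoing darts at the vertex
  let q : Perm {d // M.IsOut d ∧ M.vertexOf d = M.vertexOf d₀} := (M.rot ^ 2).subtypePerm hrr
  let ι : {d // M.IsOut d ∧ M.vertexOf d = M.vertexOf d₀} ↪ X :=
    ⟨fun d => thr d.1, fun d d' h =>
      Subtype.ext (hinj _ _ d.2.1 d'.2.1 (d.2.2.trans d'.2.2.symm) h)⟩
  have happ : ∀ d, M.IsOut d → M.vertexOf d = M.vertexOf d₀ →
      q.viaEmbedding ι (thr d) = thr (M.rot d) := by
    intro d h1 h2
    have hr : ¬ M.IsOut (M.rot d) := by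
      rw [hal d (hne d h2), not_not]
      exact h1
    rw [← hin (M.rot d) hr (hne _ ((vertexOf_rot d).trans h2))]
    exact q.viaEmbedding_apply ι ⟨d, h1, h2⟩
  have hmov : ∀ x, q.viaEmbedding ι x ≠ x ↔
      ∃ d, M.IsOut d ∧ M.vertexOf d = M.vertexOf d₀ ∧ thr d = x := by
    intro x
    constructor
    · intro hx
      by_contra hc
      refine hx (q.viaEmbedding_apply_of_notMem ι x ?_)
      rintro ⟨d, rfl⟩
      exact hc ⟨d.1, d.2.1, d.2.2, rfl⟩
    · rintro ⟨d, h1, h2, rfl⟩ hc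
      have h3 : ι (q ⟨d, h1, h2⟩) = ι ⟨d, h1, h2⟩ := by
        rw [← q.viaEmbedding_apply ι]
        exact hc
      exact rot_rot_ne hal hv (hne d h2) (congrArg Subtype.val (ι.injective h3))
  refine ⟨q.viaEmbedding ι, ?_, happ, hmov⟩
  obtain ⟨d₁, h1, h2⟩ : ∃ d, M.IsOut d ∧ M.vertexOf d = M.vertexOf d₀ := by
    by_cases h : M.IsOut d₀
    · exact ⟨d₀, h, rfl⟩
    · exact ⟨M.rot d₀, (hal d₀ hd₀).2 h, vertexOf_rot d₀⟩
  refine ⟨thr d₁, (hmov _).2 ⟨d₁, h1, h2, rfl⟩, fun y hy => ?_⟩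
  obtain ⟨d, h3, h4, rfl⟩ := (hmov y).1 hy
  obtain ⟨k, rfl⟩ := (vertexOf_eq_iff.1 (h2.trans h4.symm)).exists_nat_pow_eq
  clear hy h3 h4
  induction k with
  | zero => exact .rfl
  | succ k ih =>
    have hk : M.vertexOf ((M.rot ^ k) d₁) = M.vertexOf d₀ :=
      (vertexOf_eq_iff.2 (Perm.sameCycle_pow_left.2 .rfl)).trans h2
    rw [pow_succ', Perm.mul_apply]
    by_cases ho : M.IsOut ((M.rot ^ k) d₁)
    · rw [← happ _ ho hk]
      exact Perm.sameCycle_apply_right.2 ih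
    · rwa [hin _ ho (hne _ hk)]

/-- An acyclic alternating map whose vertices are sources, sinks, or of even degree at least `4`
has a reading. -/
theorem exists_isReading {n : ℕ} (hac : M.IsAcyclic) (hal : M.IsAlternating)
    (hv : ∀ v, M.IsSource v ∨ M.IsSink v ∨ (Even (M.degree v) ∧ 4 ≤ M.degree v))
    (hn : Nat.card {d // M.IsOut d ∧ M.rot d = d} = n) :
    ∃ (f : List (Perm (Fin n))) (thr : M.Dart → Fin n) (lev : M.Dart → ℕ),
      (∀ s ∈ f, s.IsCycle) ∧ IsReading M.rot M.opp M.IsOut f thr lev := by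
  obtain ⟨thr, topp, trot, tsrc, ttot⟩ := exists_threads hac hal (Finite.equivFinOfCardEq hn)
  obtain ⟨r, lev, lle, l0, lr, lv, lex, llt⟩ := exists_levels hac
  have hinj : ∀ d d', M.IsOut d → M.IsOut d' → M.vertexOf d = M.vertexOf d' → thr d = thr d' →
      d = d' := by
    intro d d' hd hd' hvd ht
    by_contra hne
    rcases ttot d d' hd hd' ht with h | h
    · exact hac _ (hvd ▸ arc_of_reflTransGen h hne)
    · exact hac _ (hvd ▸ arc_of_reflTransGen h (Ne.symm hne))
  choose d₀ hd₀ hlev₀ using lex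
  choose σ hcyc happ hmov using fun i hi => exists_factor hal hv trot hinj (hd₀ i hi)
  have hlen : (List.ofFn fun i : Fin r => σ i.1 i.2).length = r := List.length_ofFn
  have hfac : ∀ i (hi : i < r), fac (List.ofFn fun i : Fin r => σ i.1 i.2) i = σ i hi := by
    intro i hi
    simp [fac, hi]
  have hvert : ∀ i (hi : i < r) d, lev d = i + 1 ↔ M.vertexOf d = M.vertexOf (d₀ i hi) := by
    intro i hi d
    rw [← hlev₀ i hi, eq_comm, lv _ _ (hd₀ i hi), eq_comm]
  have hinner : ∀ d, M.rot d ≠ d → ∃ i, i < r ∧ lev d = i + 1 := by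
    intro d hd
    have h1 := lle d
    have h2 : lev d ≠ 0 := fun h => hd ((l0 d).1 h).2
    have h3 : lev d ≠ r + 1 := fun h => hd ((lr d).1 h).2
    exact ⟨lev d - 1, by omega, by omega⟩
  have hlevrot : ∀ d, lev (M.rot d) = lev d := by
    intro d
    by_cases hd : M.rot d = d
    · rw [hd]
    · exact ((lv d _ hd).2 (vertexOf_rot d).symm).symm
  have hout : ∀ i (hi : i < r) x, σ i hi x ≠ x → ∃ d, M.IsOut d ∧ thr d = x ∧ lev d = i + 1 := by
    intro i hi x hx
    obtain ⟨d, h1, h2, h3⟩ := (hmov i hi x).1 hx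
    exact ⟨d, h1, h3, (hvert i hi d).2 h2⟩
  have hrange : ∀ i x, fac (List.ofFn fun i : Fin r => σ i.1 i.2) i x ≠ x → i < r := by
    intro i x hx
    rw [← hlen]
    exact lt_of_fac_ne _ hx
  have hmono : ∀ d d', ReflTransGen M.Step d d' → lev d ≤ lev d' := by
    intro d d' h
    induction h with
    | refl => exact le_rfl
    | tail _ h ih =>
      rw [h.2.2, hlevrot]
      exact ih.trans (llt _ h.1).le
  refine ⟨List.ofFn fun i : Fin r => σ i.1 i.2, thr, lev, ?_, ?_⟩
  · intro s hs
    obtain ⟨i, rfl⟩ := List.mem_ofFn.1 hs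
    exact hcyc _ _
  refine
    { opp_opp := M.opp_opp
      out_opp := M.isOut_opp
      inj := ?_
      exists_source := ?_
      exists_sink := ?_
      exists_out := ?_
      out_cases := ?_
      in_cases := ?_
      rot_source := fun d _ h => ((l0 d).1 h).2
      rot_sink := fun d _ h => ((lr d).1 (h.trans (by rw [hlen]))).2
      rot_out := ?_
      rot_in := ?_
      thr_opp := topp
      lev_lt := llt
      gap := ?_ }
  · -- outgoing darts first; the case of incoming darts is reduced to it
    have main : ∀ d d', M.IsOut d → M.IsOut d' → thr d = thr d' → lev d = lev d' → d = d' := by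
      intro d d' hd hd' ht hl
      by_cases hr : M.rot d = d
      · have hr' : M.rot d' = d' := ((l0 d').1 (hl ▸ (l0 d).2 ⟨hd, hr⟩)).2
        rcases ttot d d' hd hd' ht with h | h
        · exact reflTransGen_source_eq hr' h
        · exact (reflTransGen_source_eq hr h).symm
      · exact hinj d d' hd hd' ((lv d d' hr).1 hl) ht
    intro d d' ht hl ho
    by_cases hd : M.IsOut d
    · exact main d d' hd (ho.1 hd) ht hl
    have hd' : ¬ M.IsOut d' := fun h => hd (ho.2 h)
    by_cases hr : M.rot d = d
    · have hr' : M.rot d' = d' := ((lr d').1 (hl ▸ (lr d).2 ⟨hd, hr⟩)).2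
      -- the last edge of a thread has no successor
      have hlast : ∀ d e, ¬ M.IsOut d → M.rot d = d → ReflTransGen M.Step (M.opp d) e →
          M.opp d = e := by
        intro d e hd hr h
        rcases h.cases_head with h | ⟨c, h, -⟩
        · exact h
        · refine absurd h.2.1 ?_
          rwa [h.2.2, M.opp_opp, hr]
      refine M.opp.injective ?_
      rcases ttot (M.opp d) (M.opp d') ((M.isOut_opp d).2 hd) ((M.isOut_opp d').2 hd')
        (by rw [topp, topp, ht]) with h | h
      · exact hlast d _ hd hr h
      · exact (hlast d' _ hd' hr' h).symm
    · have hr' : M.rot d' ≠ d' := fun h => hr (((lr d).1 (hl ▸ (lr d').2 ⟨hd', h⟩)).2)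
      refine M.rot.injective (main _ _ ((hal d hr).2 hd) ((hal d' hr').2 hd') ?_ ?_)
      · rw [trot d hd hr, trot d' hd' hr', ht]
      · rw [hlevrot, hlevrot, hl]
  · intro x
    obtain ⟨s, h1, h2, h3⟩ := tsrc x
    exact ⟨s, h1, h3, (l0 s).2 ⟨h1, h2⟩⟩
  · have key : ∀ d, M.IsOut d → ∃ t, ¬ M.IsOut t ∧ thr t = thr d ∧ lev t = r + 1 := by
      intro d hd
      generalize hvd : M.vertexOf d = v
      induction v using (wellFounded_swap_arc hac).induction generalizing d with
      | _ v ih =>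
        subst hvd
        have ho := not_isOut_opp hd
        by_cases hr : M.rot (M.opp d) = M.opp d
        · exact ⟨M.opp d, ho, topp d, (lr _).2 ⟨ho, hr⟩⟩
        · have hst : M.Step d (M.rot (M.opp d)) := ⟨hd, (hal _ hr).2 ho, rfl⟩
          obtain ⟨t, h1, h2, h3⟩ := ih _ (.single hst.arc) _ hst.2.1 rfl
          exact ⟨t, h1, by rw [h2, trot _ ho hr, topp], h3⟩
    intro x
    obtain ⟨s, h1, -, h3⟩ := tsrc x
    obtain ⟨t, h4, h5, h6⟩ := key s h1
    exact ⟨t, h4, h5.trans h3, by rw [h6, hlen]⟩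
  · intro x i hx
    have hi := hrange i x hx
    rw [hfac i hi] at hx
    exact hout i hi x hx
  · intro d hd
    by_cases hr : M.rot d = d
    · exact .inl ((l0 d).2 ⟨hd, hr⟩)
    · obtain ⟨i, hi, hl⟩ := hinner d hr
      refine .inr ⟨i, hl, ?_⟩
      rw [hfac i hi]
      exact (hmov i hi _).2 ⟨d, hd, (hvert i hi d).1 hl, rfl⟩
  · intro d hd
    by_cases hr : M.rot d = d
    · exact .inl (((lr d).2 ⟨hd, hr⟩).trans (by rw [hlen]))
    · obtain ⟨i, hi, hl⟩ := hinner d hr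
      refine .inr ⟨i, hl, ?_⟩
      rw [hfac i hi]
      exact (hmov i hi _).2 ⟨M.rot d, (hal d hr).2 hd,
        (vertexOf_rot d).trans ((hvert i hi d).1 hl), trot d hd hr⟩
  · intro d i hd hl
    have hr : M.rot d ≠ d := fun h => by
      have := (l0 d).2 ⟨hd, h⟩
      omega
    obtain ⟨j, hj, hl'⟩ := hinner d hr
    obtain rfl : i = j := by omega
    refine ⟨fun h => (hal d hr).1 h hd, ?_, by rw [hlevrot, hl]⟩
    rw [hfac i hj, happ i hj d hd ((hvert i hj d).1 hl)]
  · intro d hd hl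
    have hr : M.rot d ≠ d := fun h => hl (((lr d).2 ⟨hd, h⟩).trans (by rw [hlen]))
    exact ⟨(hal d hr).2 hd, trot d hd hr, hlevrot d⟩
  · intro d i hd h1 h2
    by_contra hx
    have hi := hrange i _ hx
    rw [hfac i hi] at hx
    obtain ⟨e, h3, h4, h5⟩ := hout i hi _ hx
    -- the crossing `e` precedes or follows `d` on their thread, and lies in the gap in neither case
    rcases ttot d e hd h3 h4.symm with h | h
    · rcases h.cases_head with h | ⟨c, h6, h7⟩
      · subst h
        omega
      · have := hmono _ _ h7
        rw [h6.2.2, hlevrot] at this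
        omega
    · have := hmono _ _ h
      omega

end DirectedMap

/-! ### Factorizations and admissible decorated maps -/

section Correspondence

variable {n m : ℕ} {p : Perm (Fin n)} {a : Fin m → ℕ} {c : Fin n → Fin m} {b : Fin m → Fin n}

/-- A decorated map is admissible if and only if the list of cycles read off it is a factorization of
the prescribed genus and signature. -/
theorem isAdmissible_iff_isCycleFactorization (hm : numCycles p = m)
    (hc : ∀ x y, c x = c y ↔ p.SameCycle x y) (ha : ∀ i, Nat.card {x // c x = i} = a i)
    (hb : ∀ i, c (b i) = i) (g : ℕ) (β : ℕ →₀ ℕ) {M : DecoratedMap m} {f : List (Perm (Fin n))}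
    {thr : M.Dart → Fin n} {lev : M.Dart → ℕ} (h : IsRootedReading b M f thr lev)
    (hf : ∀ s ∈ f, s.IsCycle) (hp : f.prod = p) :
    IsAdmissible a g β M ↔ IsCycleFactorization p g β f := by
  subst hp
  have hr := h.isReading
  have hgenus : M.HasGenus g ↔ HasGenus f g :=
    hr.hasGenus_iff hf c hc (fun i => ⟨b i, hb i⟩) hm g
  have hfib : ∀ i d, M.faceOf d = M.label.symm i →
      Nat.card {x // f.prod.SameCycle x (faceSymbol M.IsOut f thr lev d)} = a i := by
    intro i d hd
    rw [← ha]
    refine Nat.card_congr (Equiv.subtypeEquivRight fun x => ?_)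
    rw [← hc, ← h.label_eq c hc hb, hd, Equiv.apply_symm_apply]
  constructor
  · intro hM
    exact ⟨hf, rfl, hgenus.1 hM.genus, fun k hk => by
      rw [← hr.card_degree_eq hf hk, hM.degrees k hk]⟩
  · intro hF
    exact
      { acyclic := hr.isAcyclic
        alternating := hr.isAlternating
        genus := hgenus.2 hF.genus
        vertex := hr.vertex_cases hf
        sources := fun i => by
          obtain ⟨d, hd⟩ := DirectedMap.exists_faceOf_eq (M.label.symm i)
          rw [← hfib i d hd, ← hr.card_source, hd]
        sinks := fun i => by
          obtain ⟨d, hd⟩ := DirectedMap.exists_faceOf_eq (M.label.symm i)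
          rw [← hfib i d hd, ← hr.card_sink, hd]
        degrees := fun k hk => by rw [hr.card_degree_eq hf hk, hF.signature_eq k hk] }

theorem rot_eq_self_of_isSource {M : DirectedMap} (hal : M.IsAlternating) {d : M.Dart}
    (hd : M.IsSource (M.vertexOf d)) : M.rot d = d := by
  by_contra hr
  exact (hal d hr).1 (hd _ (M.vertexOf_rot d)) (hd d rfl)

theorem isSource_vertexOf {M : DirectedMap} {d : M.Dart} (hd : M.IsOut d) (hr : M.rot d = d) :
    M.IsSource (M.vertexOf d) := by
  intro e he
  rwa [(DirectedMap.vertexOf_eq_iff.1 he).eq_of_right hr]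

/-- Sources being leaves, each of them is counted in exactly one face. -/
theorem card_source_darts {g : ℕ} {β : ℕ →₀ ℕ} {M : DecoratedMap m} (hM : IsAdmissible a g β M) :
    Nat.card {d // M.IsOut d ∧ M.rot d = d} = ∑ i, a i := by
  rw [← Finset.sum_congr rfl fun i _ => hM.sources i, ← Nat.card_sigma]
  refine Nat.card_congr (Equiv.ofBijective (fun d => ⟨M.label (M.faceOf d.1), M.vertexOf d.1,
    isSource_vertexOf d.2.1 d.2.2, d.1, rfl, by simp⟩) ⟨?_, ?_⟩)
  · intro d d' h
    have hv : M.vertexOf d.1 = M.vertexOf d'.1 := by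
      simp only [Sigma.mk.injEq] at h
      obtain ⟨h1, h2⟩ := h
      rw [Subtype.heq_iff_coe_eq (by simp [h1])] at h2
      exact h2
    exact Subtype.ext ((DirectedMap.vertexOf_eq_iff.1 hv).eq_of_left d.2.2)
  · rintro ⟨i, v, hv, d, rfl, hd⟩
    refine ⟨⟨d, hv d rfl, rot_eq_self_of_isSource hM.alternating hv⟩, ?_⟩
    obtain rfl : i = M.label (M.faceOf d) := by rw [hd, Equiv.apply_symm_apply]
    rfl

/-- Every admissible decorated map has a reading of a factorization of the given permutation. -/
theorem exists_isRootedReading_of_isAdmissible (hn : ∑ i, a i = n)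
    (hc : ∀ x y, c x = c y ↔ p.SameCycle x y) (ha : ∀ i, Nat.card {x // c x = i} = a i)
    (hb : ∀ i, c (b i) = i) {g : ℕ} {β : ℕ →₀ ℕ} {M : DecoratedMap m}
    (hM : IsAdmissible a g β M) :
    ∃ (f : List (Perm (Fin n))) (thr : M.Dart → Fin n) (lev : M.Dart → ℕ),
      (∀ s ∈ f, s.IsCycle) ∧ f.prod = p ∧ IsRootedReading b M f thr lev := by
  obtain ⟨f, thr, lev, hf, h⟩ := DirectedMap.exists_isReading hM.acyclic hM.alternating hM.vertex
    ((card_source_darts hM).trans hn)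
  choose s hs using h.exists_source
  have hsym : ∀ x, faceSymbol M.IsOut f thr lev (s x) = x := fun x => by
    rw [faceSymbol, if_pos (hs x).1, (hs x).2.1]
  have hs' : ∀ d, lev d = 0 → s (thr d) = d := fun d hd =>
    h.inj _ _ (hs _).2.1 ((hs _).2.2.trans hd.symm) (by
      simp [(hs _).1, h.isOut_of_lev_eq_zero hd])
  let c₀ : Fin n → Fin m := fun x => M.label (M.faceOf (s x))
  have hc₀ : ∀ x y, c₀ x = c₀ y ↔ f.prod.SameCycle x y := by
    intro x y
    rw [M.label.apply_eq_iff_eq, h.faceOf_eq_iff, hsym, hsym]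
  have hex : ∀ i, ∃ d, lev d = 0 ∧ M.vertexOf d = M.root i ∧ M.label (M.faceOf d) = i := by
    intro i
    obtain ⟨d, h1, h2⟩ := M.root_incident i
    exact ⟨d, h.isSource_iff.1 (h1 ▸ M.root_isSource i), h1, by rw [h2, Equiv.apply_symm_apply]⟩
  choose ρ hρ using hex
  have hb₀ : ∀ i, c₀ (thr (ρ i)) = i := fun i => by
    change M.label (M.faceOf (s (thr (ρ i)))) = i
    rw [hs' _ (hρ i).1, (hρ i).2.2]
  have ha₀ : ∀ i, Nat.card {x // c₀ x = i} = Nat.card {x // c x = i} := by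
    intro i
    have hface : M.label.symm i = M.faceOf (ρ i) := by
      rw [Equiv.symm_apply_eq, (hρ i).2.2]
    rw [ha, ← hM.sources i, hface, h.card_source]
    refine Nat.card_congr (Equiv.subtypeEquivRight fun x => ?_)
    rw [faceSymbol, if_pos (h.isOut_of_lev_eq_zero (hρ i).1), ← hc₀, hb₀]
  -- the sources were labelled arbitrarily, so the product has only the right cycle lengths so far
  obtain ⟨t, ht, htb⟩ := exists_conj_of_cycleIndex f.prod p c₀ c hc₀ hc ha₀ (fun i => thr (ρ i)) b
    hb₀ hb
  refine ⟨f.map fun s => t * s * t⁻¹, fun d => t (thr d), lev, ?_, ?_, h.conj t, ?_⟩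
  · intro u hu
    obtain ⟨v, hv, rfl⟩ := List.mem_map.1 hu
    exact (hf v hv).conj
  · have := (map_list_prod (MulAut.conj t) f).symm
    rw [MulAut.conj_apply] at this
    refine Eq.trans (congrArg List.prod (List.map_congr_left fun s _ => rfl)) (this.trans ?_)
    ext x : 1
    rw [Perm.mul_apply, Perm.mul_apply, ht]
    simp
  · intro i d hd hti
    have : thr d = thr (ρ i) := t.injective (hti.trans (htb i).symm)
    rw [← hs' d hd, this, hs' _ (hρ i).1, (hρ i).2.1]

/-- The correspondence, for a permutation whose cycles are indexed by the faces of the maps, with a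
base point in each cycle. -/
theorem nonempty_equiv (hn : 0 < n) (han : ∑ i, a i = n) (hm : numCycles p = m)
    (hc : ∀ x y, c x = c y ↔ p.SameCycle x y) (ha : ∀ i, Nat.card {x // c x = i} = a i)
    (hb : ∀ i, c (b i) = i) (g : ℕ) (β : ℕ →₀ ℕ) :
    Nonempty (IneqFactorization p g β ≃ MapClass a g β) := by
  have hcyc : ∀ f : {f : List (Perm (Fin n)) // IsCycleFactorization p g β f},
      ∀ x y, c x = c y ↔ f.1.prod.SameCycle x y := fun f => by
    rw [f.2.prod_eq]
    exact hc
  have hbase : ∀ f : {f : List (Perm (Fin n)) // IsCycleFactorization p g β f},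
      ∀ x, ∃ i, f.1.prod.SameCycle (b i) x := fun f x => ⟨c x, (hcyc f _ _).1 (hb _)⟩
  choose M thr lev hM using fun f : {f : List (Perm (Fin n)) // IsCycleFactorization p g β f} =>
    exists_isRootedReading hn f.1 f.2.genus.1 c (hcyc f) b hb
  let Φ : {f : List (Perm (Fin n)) // IsCycleFactorization p g β f} →
      {M : DecoratedMap m // IsAdmissible a g β M} := fun f =>
    ⟨M f, (isAdmissible_iff_isCycleFactorization hm hc ha hb g β (hM f) f.2.isCycle
      f.2.prod_eq).2 f.2⟩
  have hΦ : ∀ f f', Relation.EqvGen SwapStep f.1 f'.1 ↔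
      Nonempty (DecoratedMap.Iso (Φ f).1 (Φ f').1) := by
    intro f f'
    constructor
    · intro hff
      obtain ⟨lev', h'⟩ := (hM f).of_eqvGen hff
      exact h'.nonempty_iso (hM f') c (hcyc f') hb
    · rintro ⟨e⟩
      exact (hM f).eqvGen ((hM f').comp_iso e) f.2.isCycle f'.2.isCycle
        (f.2.prod_eq.trans f'.2.prod_eq.symm) (hbase f)
  let F : IneqFactorization p g β → MapClass a g β := Quotient.lift
    (fun f => Quotient.mk _ (Φ f)) fun f f' hff => Quotient.sound ((hΦ f f').1 hff)
  refine ⟨Equiv.ofBijective F ⟨?_, ?_⟩⟩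
  · intro x y
    refine Quotient.inductionOn₂ x y fun f f' hff => ?_
    exact Quotient.sound ((hΦ f f').2 (Quotient.exact hff))
  · intro y
    refine Quotient.inductionOn y fun N => ?_
    obtain ⟨f, thr', lev', hf, hp, h⟩ :=
      exists_isRootedReading_of_isAdmissible han hc ha hb N.2
    let f₁ : {f : List (Perm (Fin n)) // IsCycleFactorization p g β f} :=
      ⟨f, (isAdmissible_iff_isCycleFactorization hm hc ha hb g β h hf hp).1 N.2⟩
    exact ⟨Quotient.mk _ f₁, Quotient.sound ((hM f₁).nonempty_iso h c (hcyc f₁) hb)⟩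

end Correspondence

end CycleFact

theorem theorem2p3 {n : ℕ} (hn : 0 < n) (α : Composition n) (p : Equiv.Perm (Fin n))
    (hp : p.partition.parts = (α.blocks : Multiset ℕ)) (g : ℕ) (β : ℕ →₀ ℕ) :
    Nonempty (CycleFact.IneqFactorization p g β ≃ CycleFact.MapClass α.blocksFun g β) := by
  have hparts : p.partition.parts = (Finset.univ : Finset (Fin α.length)).val.map α.blocksFun := by
    rw [hp, Fin.univ_val_map, Composition.ofFn_blocksFun]
  obtain ⟨c, hc, ha⟩ := CycleFact.exists_cycleIndex p α.blocksFun hparts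
  have hne : ∀ i, ∃ x, c x = i := by
    intro i
    have hpos : 0 < Nat.card {x // c x = i} := by
      rw [ha]
      exact α.one_le_blocksFun i
    obtain ⟨⟨x, hx⟩⟩ := (Nat.card_pos_iff.1 hpos).1
    exact ⟨x, hx⟩
  choose b hb using hne
  refine CycleFact.nonempty_equiv hn α.sum_blocksFun ?_ hc ha hb g β
  rw [CycleFact.numCycles, hp]
  rfl
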